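/- **Setting.** For a finite simple graph $G$ on the node set $\{1,\dots,p\}$ that is a disjoint union of cliques, and $\tau\in(0,1)$, let $P_G$ be the centred Gaussian law on $\mathbb{R}^p$ whose inverse covariance matrix $\Theta$ has $\Theta_{uu}=1$, $\Theta_{uv}=\tau$ if $\{u,v\}$ is an edge of $G$, and $\Theta_{uv}=0$ otherwise. An active learning algorithm proceeds in rounds $i=1,\dots,N$: in round $i$ it chooses a set $Z^{(i)}$ of nodes as a measurable function of the observations of the previous rounds (and possibly of private randomness independent of the samples); a fresh sample of $P_G$, independent between rounds, is drawn, and the algorithm sees its entries on $Z^{(i)}$ only, all other entries being replaced by a "missing" symbol. After round $N$ it outputs a graph $\hat G$, a measurable function of all observations (and the private randomness). It uses at most $n$ node observations if $\sum_{i=1}^N |Z^{(i)}|\le n$ almost surely. For a finite class $\mathcal T$ of graphs, its average error probability is $\bar P_{\mathrm e}=\frac1{|\mathcal T|}\sum_{G\in\mathcal T}\mathbb P_G[\hat G\ne G]$. For integers $m_1,\dots,m_L\ge 2$ with $\sum_j m_j=p$, let $\mathcal T(m_1,\dots,m_L)$ be the set of all graphs on $\{1,\dots,p\}$ that consist of $L$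 disjoint cliques with $m_1,\dots,m_L$ nodes. Put $d_{\max}=\max_j m_j-1$ and, for $\alpha\in(0,1)$, let $d_{\min}^{(\alpha)}$ be the minimum degree among the $\lfloor\alpha p\rfloor$ nodes of largest degree (defined when $\lfloor\alpha p\rfloor\ge1$; it is the same for every graph of $\mathcal T(m_1,\dots,m_L)$). **Lemma.** Fix $\alpha\in(0,1)$ and a sequence of clique profiles $(m_1,\dots,m_L)$ as above (with $L$, $p$ and the $m_j$ depending on the index of the sequence) such that $p\to\infty$ and $\max_j m_j=o(p)$. Then there is a sequence $o(1)$ tending to $0$, depending only on $\alpha$ and on the sequence of profiles, such that along the sequence the following holds for all $\tau\in(0,1)$, all real $\delta$ and all $n\in\mathbb N$: whenever an active learning algorithm uses at most $n$ node observations for every graph in $\mathcal T(m_1,\dots,m_L)$ and has $\bar P_{\mathrm e}\le\delta$ for $G$ uniform on $\mathcal T(m_1,\dots,m_L)$, then, provided $\lfloor\alpha p\rfloor\ge1$, $$ n \;\ge\; \frac{2\alpha\, p\, d_{\min}^{(\alpha)}\,\log\frac{p}{d_{\max}}}{\log\Big(1+\big((d_{\max}+1)\frac{\tau}{1-\tau}\big)^2\Big)}\,\bigl(1-\delta-o(1)\bigr).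 $$ -/

import Mathlib

open MeasureTheory ProbabilityTheory Filter Topology

/-- `G` is a disjoint union of `L` cliques on node sets of the prescribed sizes `m 0, …, m (L - 1)`:
two distinct nodes are adjacent exactly when they lie in a common clique. -/
def IsDisjointCliques {p L : ℕ} (m : Fin L → ℕ) (G : SimpleGraph (Fin p)) : Prop :=
  ∃ C : Fin L → Finset (Fin p),
    (∀ j, (C j).card = m j) ∧
    (∀ i j, i ≠ j → Disjoint (C i) (C j)) ∧
    ∀ u v, G.Adj u v ↔ u ≠ v ∧ ∃ j, u ∈ C j ∧ v ∈ C j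

open Classical in
/-- The ensemble of all graphs on `p` nodes made of disjoint cliques of the prescribed sizes. -/
noncomputable def cliqueEnsemble (p : ℕ) {L : ℕ} (m : Fin L → ℕ) :
    Finset (SimpleGraph (Fin p)) :=
  Finset.univ.filter fun G => IsDisjointCliques m G

/-- The largest degree occurring in a graph of the ensemble: largest clique size minus one. -/
def maxCliqueDegree {L : ℕ} (m : Fin L → ℕ) : ℕ :=
  Finset.univ.sup m - 1

open Classical in
/-- `d` is the minimum degree among `k` nodes of `G` having the largest degrees. -/
def IsMinTopDegree {p : ℕ} (G : SimpleGraph (Fin p)) (k d : ℕ) : Prop :=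
  ∃ S : Finset (Fin p), S.card = k ∧
    (∀ u ∈ S, ∀ v ∉ S, G.degree v ≤ G.degree u) ∧
    IsLeast {e : ℕ | ∃ u ∈ S, G.degree u = e} d

open Classical in
/-- The inverse covariance matrix of the Gaussian graphical model on `G` with parameter `τ`
(positive definite for `0 < τ < 1` when `G` is a disjoint union of cliques). -/
noncomputable def precisionMatrix {p : ℕ} (τ : ℝ) (G : SimpleGraph (Fin p)) :
    Matrix (Fin p) (Fin p) ℝ :=
  Matrix.of fun u v => if u = v then 1 else if G.Adj u v then τ else 0

/-- The law `P_G` of the Gaussian graphical model: centred, with inverse covariance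
`precisionMatrix τ G`. -/
noncomputable def gaussianModel {p : ℕ} (τ : ℝ) (G : SimpleGraph (Fin p)) :
    Measure (EuclideanSpace ℝ (Fin p)) :=
  multivariateGaussian 0 (precisionMatrix τ G)⁻¹

instance {p : ℕ} (τ : ℝ) (G : SimpleGraph (Fin p)) :
    IsProbabilityMeasure (gaussianModel τ G) := by
  unfold gaussianModel
  infer_instance

/-- What is seen in one round: a real value at each observed node, and the symbol `Sum.inr ()`
(missing) at each other node. -/
abbrev Observation (p : ℕ) : Type := Fin p → ℝ ⊕ Unit

/-- Observe the nodes in `z` of the full sample `x`. -/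
def observe {p : ℕ} (z : Finset (Fin p)) (x : EuclideanSpace ℝ (Fin p)) : Observation p :=
  fun v => if v ∈ z then Sum.inl (x v) else Sum.inr ()

/-- An active learning algorithm on `p` nodes, possibly with private randomness (the seed).
In round `i` it selects the nodes to observe as a function of the seed and of the observations
of the previous `i` rounds; after the last round it outputs a graph. -/
structure ActiveLearner (p : ℕ) where
  Seed : Type
  [seedMeasurableSpace : MeasurableSpace Seed]
  seedLaw : Measure Seed
  [seedProbability : IsProbabilityMeasure seedLaw]
  /-- the maximum number of rounds -/
  rounds : ℕ
  select : (i : ℕ) → Seed → (Fin i → Observation p) → Finset (Fin p)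
  estimate : Seed → (Fin rounds → Observation p) → SimpleGraph (Fin p)
  measurable_select : ∀ i, Measurable fun q : Seed × (Fin i → Observation p) => select i q.1 q.2
  measurable_estimate :
    Measurable fun q : Seed × (Fin rounds → Observation p) => estimate q.1 q.2

namespace ActiveLearner

variable {p : ℕ}

attribute [instance] seedMeasurableSpace seedProbability

/-- The observations of the first `i` rounds, when the seed is `s` and the (partly hidden) full
sample of round `k` is `Y k`. -/
def history (A : ActiveLearner p) (s : A.Seed) (Y : ℕ → EuclideanSpace ℝ (Fin p)) :
    (i : ℕ) → Fin i → Observation p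
  | 0 => Fin.elim0
  | i + 1 => Fin.snoc (α := fun _ => Observation p) (A.history s Y i)
      (observe (A.select i s (A.history s Y i)) (Y i))

/-- The total number of node observations over all rounds. -/
def totalObservations (A : ActiveLearner p) (s : A.Seed)
    (Y : ℕ → EuclideanSpace ℝ (Fin p)) : ℕ :=
  ∑ i ∈ Finset.range A.rounds, (A.select i s (A.history s Y i)).card

/-- The joint law of the seed and of the full samples, which are independent between rounds
with law `P_G`. -/
noncomputable def law (A : ActiveLearner p) (τ : ℝ) (G : SimpleGraph (Fin p)) :
    Measure (A.Seed × (ℕ → EuclideanSpace ℝ (Fin p))) :=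
  A.seedLaw.prod (Measure.infinitePi fun _ : ℕ => gaussianModel τ G)

/-- The probability that the estimate differs from the true graph `G`. -/
noncomputable def errorProb (A : ActiveLearner p) (τ : ℝ) (G : SimpleGraph (Fin p)) : ℝ :=
  (A.law τ G).real {ω | A.estimate ω.1 (A.history ω.1 ω.2 A.rounds) ≠ G}

/-- The average error probability when the graph is uniform on the finite class `T`. -/
noncomputable def avgErrorProb (A : ActiveLearner p) (τ : ℝ)
    (T : Finset (SimpleGraph (Fin p))) : ℝ :=
  (∑ G ∈ T, A.errorProb τ G) / T.card

/-- The algorithm never uses more than `n` node observations, whichever graph of `T` is true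
(almost surely). -/
def WithinBudget (A : ActiveLearner p) (τ : ℝ) (T : Finset (SimpleGraph (Fin p))) (n : ℕ) :
    Prop :=
  ∀ G ∈ T, ∀ᵐ ω ∂A.law τ G, A.totalObservations ω.1 ω.2 ≤ n

end ActiveLearner

/-! The proof is Fano's inequality for adaptive sampling, with part of the graph revealed. Let `d`
be the minimum top degree, `B` the set of cliques with at least `d + 1` nodes and `P` the number of
nodes in them, so that `P ≥ ⌊α p⌋`. The cliques outside `B` are revealed: a permutation `σ` of all
nodes fixes where everything lies, and only a permutation `π` of the `P` nodes remains unknown.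
Averaging over `σ` restores the uniform law on the ensemble (`sum_perm_cliqueGraph`).

All graphs with the same `σ` share a reference law (`referenceLaw_relabel`). Seeing a set `z` of
nodes separates the model from it by a divergence of at most `|z| Λ / (2 (d + 1))`, where `Λ` is the
logarithm in the denominator of the theorem (`gibbsBound_observe`): the divergence of `k` observed
nodes in a clique of size `m` is convex in `k` and zero at `k = 0`, hence at most `k / m` times that
of the whole clique. The chain rule `integral_log_history_le` adds these costs over rounds, although
the sets are chosen adaptively.

On the other side, a graph comes from at most `P ^ l * M ^ (P - l)` of the `P!` permutations `π`,
with `l = |B|` and `M` the largest clique size (`card_relabel_eq_le`). Under the reference law the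
average chance of a correct guess is thus at most `1 / κ`, with `κ` the quotient of these numbers.
As `l ≤ P / (d + 1)`, `log κ` is at least about `P * (d / (d + 1)) * log (P / M)`. In the comparison
of `log κ` with `n Λ / (2 (d + 1))` the factors `d + 1` cancel and `d` is left.

Divergences enter only through `GibbsBound`, the Donsker–Varadhan inequality on bounded functions,
which passes to images and products without any densities. -/

/-- `P` satisfies the Donsker–Varadhan inequality with respect to `Q` with constant `D`, on
bounded functions: this says that the Kullback–Leibler divergence of `P` from `Q` is at most `D`. -/
def GibbsBound {Ω : Type*} [MeasurableSpace Ω] (P Q : Measure Ω) (D : ℝ) : Prop :=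
  ∀ (g : Ω → ℝ) (K : ℝ), Measurable g → (∀ x, 1 ≤ g x) → (∀ x, g x ≤ K) →
    ∫ x, Real.log (g x) ∂P ≤ D + Real.log (∫ x, g x ∂Q)

/-! ### Calculus of Donsker–Varadhan bounds -/

section BoundedFunctions

variable {Ω : Type*} [MeasurableSpace Ω] {P : Measure Ω} {g : Ω → ℝ} {K : ℝ}

lemma integrable_of_one_le_le [IsFiniteMeasure P] (hg : Measurable g) (h1 : ∀ x, 1 ≤ g x)
    (hK : ∀ x, g x ≤ K) : Integrable g P :=
  Integrable.of_bound hg.aestronglyMeasurable K <| ae_of_all _ fun x => by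
    rw [Real.norm_eq_abs, abs_of_nonneg (by linarith [h1 x])]; exact hK x

lemma integrable_log_of_one_le_le [IsFiniteMeasure P] (hg : Measurable g) (h1 : ∀ x, 1 ≤ g x)
    (hK : ∀ x, g x ≤ K) : Integrable (fun x => Real.log (g x)) P :=
  Integrable.of_bound (Real.measurable_log.comp hg).aestronglyMeasurable (Real.log K) <|
    ae_of_all _ fun x => by
      rw [Real.norm_eq_abs, abs_of_nonneg (Real.log_nonneg (h1 x))]
      exact Real.log_le_log (by linarith [h1 x]) (hK x)

lemma one_le_integral [IsProbabilityMeasure P] (hg : Measurable g) (h1 : ∀ x, 1 ≤ g x)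
    (hK : ∀ x, g x ≤ K) : 1 ≤ ∫ x, g x ∂P := by
  have := integral_mono (μ := P) (integrable_const (1 : ℝ)) (integrable_of_one_le_le hg h1 hK) h1
  simpa using this

lemma integral_le_of_one_le_le [IsProbabilityMeasure P] (hg : Measurable g) (h1 : ∀ x, 1 ≤ g x)
    (hK : ∀ x, g x ≤ K) : ∫ x, g x ∂P ≤ K := by
  have := integral_mono (μ := P) (integrable_of_one_le_le hg h1 hK) (integrable_const K) hK
  simpa using this

end BoundedFunctions

namespace GibbsBound

variable {Ω Ω' : Type*} [MeasurableSpace Ω] [MeasurableSpace Ω']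

lemma mono {P Q : Measure Ω} {D D' : ℝ} (h : GibbsBound P Q D) (hD : D ≤ D') :
    GibbsBound P Q D' := fun g K hg h1 hK => (h g K hg h1 hK).trans (by linarith)

lemma map {P Q : Measure Ω} {D : ℝ} (h : GibbsBound P Q D) {f : Ω → Ω'} (hf : Measurable f) :
    GibbsBound (P.map f) (Q.map f) D := by
  intro g K hg h1 hK
  rw [integral_map (f := fun x => Real.log (g x)) hf.aemeasurable
      (Real.measurable_log.comp hg).aestronglyMeasurable, integral_map hf.aemeasurable hg.aestronglyMeasurable]
  exact h (g ∘ f) K (hg.comp hf) (fun x => h1 _) fun x => hK _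

/-- Here `l` is the log-density of `P` with respect to `Q`, so `∫ l ∂P` is the divergence. With `c =
∫ g ∂Q`, the variable `exp (-l) * g / c` has `P`-mean 1; integrating `log t ≤ t - 1` at it gives the
claim. -/
lemma of_withDensity {P : Measure Ω} [IsProbabilityMeasure P] {l : Ω → ℝ} {D : ℝ}
    (hlm : Measurable l) (hl : Integrable l P) (hD : ∫ x, l x ∂P ≤ D)
    [IsProbabilityMeasure (P.withDensity fun x => ENNReal.ofReal (Real.exp (-l x)))] :
    GibbsBound P (P.withDensity fun x => ENNReal.ofReal (Real.exp (-l x))) D := by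
  intro g K hg h1 hK
  set Q := P.withDensity fun x => ENNReal.ofReal (Real.exp (-l x)) with hQ
  have hm : Measurable fun x => ENNReal.ofReal (Real.exp (-l x)) := by fun_prop
  have hfin : ∀ᵐ x ∂P, ENNReal.ofReal (Real.exp (-l x)) < ⊤ := ae_of_all _ fun _ => by simp
  have hint : Integrable (fun x => Real.exp (-l x) * g x) P := by
    have := (integrable_withDensity_iff_integrable_smul' hm hfin).1
      (integrable_of_one_le_le (P := Q) hg h1 hK)
    simpa [ENNReal.toReal_ofReal (Real.exp_pos _).le] using this
  have hval : ∫ x, g x ∂Q = ∫ x, Real.exp (-l x) * g x ∂P := by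
    rw [hQ, integral_withDensity_eq_integral_toReal_smul hm hfin]
    simp [ENNReal.toReal_ofReal (Real.exp_pos _).le]
  have hc : 1 ≤ ∫ x, g x ∂Q := one_le_integral hg h1 hK
  set c := ∫ x, g x ∂Q with hcdef
  have hpt : ∀ x, Real.log (g x) ≤ (Real.exp (-l x) * g x) / c + (Real.log c - 1) + l x := by
    intro x
    have hgx : 0 < g x := by linarith [h1 x]
    have := Real.log_le_sub_one_of_pos (x := Real.exp (-l x) * g x / c) (by positivity)
    rw [Real.log_div (by positivity) (by positivity), Real.log_mul (by positivity) (by positivity),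
      Real.log_exp] at this
    linarith
  have hi1 : Integrable (fun x => (Real.exp (-l x) * g x) / c + (Real.log c - 1)) P :=
    (hint.div_const c).add (integrable_const _)
  have := integral_mono (integrable_log_of_one_le_le hg h1 hK) (hi1.add hl) hpt
  refine this.trans ?_
  simp only [Pi.add_apply]
  rw [integral_add hi1 hl, integral_add (hint.div_const c) (integrable_const _), integral_div,
    ← hval, div_self (by positivity)]
  simp
  linarith

lemma refl (P : Measure Ω) [IsProbabilityMeasure P] : GibbsBound P P 0 := by
  have h : (P.withDensity fun _ => ENNReal.ofReal (Real.exp (-(0 : ℝ)))) = P := by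
    simp
  have : IsProbabilityMeasure (P.withDensity fun _ => ENNReal.ofReal (Real.exp (-(0 : ℝ)))) := by
    rw [h]; infer_instance
  have := of_withDensity (P := P) (l := fun _ => 0) (D := 0) measurable_const
    (integrable_const _) (by simp)
  rwa [h] at this

/-- The inner integral of `g` against `Q'` again takes values in `[1, K]`, so the two bounds can be
applied one after the other. -/
lemma prod {P Q : Measure Ω} {P' Q' : Measure Ω'} [IsProbabilityMeasure P]
    [IsProbabilityMeasure Q] [IsProbabilityMeasure P'] [IsProbabilityMeasure Q'] {D D' : ℝ}
    (h : GibbsBound P Q D) (h' : GibbsBound P' Q' D') :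
    GibbsBound (P.prod P') (Q.prod Q') (D + D') := by
  intro g K hg h1 hK
  rw [integral_prod _ (integrable_log_of_one_le_le hg h1 hK),
    integral_prod _ (integrable_of_one_le_le hg h1 hK)]
  have hgx : ∀ x, Measurable fun y => g (x, y) := fun x => hg.comp measurable_prodMk_left
  have hGm : Measurable fun x => ∫ y, g (x, y) ∂Q' :=
    (hg.stronglyMeasurable.integral_prod_right' (ν := Q')).measurable
  have hG1 : ∀ x, 1 ≤ ∫ y, g (x, y) ∂Q' := fun x =>
    one_le_integral (hgx x) (fun _ => h1 _) (fun _ => hK _)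
  have hGK : ∀ x, ∫ y, g (x, y) ∂Q' ≤ K := fun x =>
    integral_le_of_one_le_le (hgx x) (fun _ => h1 _) (fun _ => hK _)
  have hli := integrable_log_of_one_le_le (P := P) hGm hG1 hGK
  calc ∫ x, ∫ y, Real.log (g (x, y)) ∂P' ∂P
      ≤ ∫ x, (D' + Real.log (∫ y, g (x, y) ∂Q')) ∂P :=
        integral_mono (integrable_log_of_one_le_le hg h1 hK).integral_prod_left
          ((integrable_const _).add hli)
          fun x => h' _ K (hgx x) (fun _ => h1 _) (fun _ => hK _)
    _ = D' + ∫ x, Real.log (∫ y, g (x, y) ∂Q') ∂P := by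
        rw [integral_add (integrable_const _) hli]; simp
    _ ≤ D' + (D + Real.log (∫ x, ∫ y, g (x, y) ∂Q' ∂Q)) := by
        gcongr; exact h _ K hGm hG1 hGK
    _ = _ := by ring

lemma pi : ∀ {n : ℕ} {P Q : Fin n → Measure Ω} [∀ i, IsProbabilityMeasure (P i)]
    [∀ i, IsProbabilityMeasure (Q i)] {D : Fin n → ℝ}, (∀ i, GibbsBound (P i) (Q i) (D i)) →
    GibbsBound (Measure.pi P) (Measure.pi Q) (∑ i, D i)
  | 0, P, Q, _, _, D, _ => by
    have hPQ : Measure.pi P = Measure.pi Q := by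
      rw [Measure.pi_of_empty, Measure.pi_of_empty]
    simpa [hPQ] using refl (Measure.pi Q)
  | n + 1, P, Q, _, _, D, h => by
    have key := (h 0).prod (pi (fun i : Fin n => h ((0 : Fin (n + 1)).succAbove i)))
    have hP := measurePreserving_piFinSuccAbove P 0
    have hQ := measurePreserving_piFinSuccAbove Q 0
    have := key.map (MeasurableEquiv.piFinSuccAbove (fun _ => Ω) (0 : Fin (n + 1))).symm.measurable
    rw [(hP.symm _).map_eq, (hQ.symm _).map_eq] at this
    refine this.mono (le_of_eq ?_)
    rw [Fin.sum_univ_succAbove _ 0]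

end GibbsBound

/-! ### Divergence between centred Gaussian laws -/

lemma gibbsBound_gaussianReal {t : NNReal} (ht : t ≠ 0) :
    GibbsBound (gaussianReal 0 t) (gaussianReal 0 1) ((t - 1 - Real.log t) / 2) := by
  have ht' : (0 : ℝ) < t := by positivity
  set l : ℝ → ℝ := fun x => x ^ 2 * ((1 - (t : ℝ)⁻¹) / 2) - Real.log t / 2 with hl
  have hden : gaussianReal 0 1 =
      (gaussianReal 0 t).withDensity fun x => ENNReal.ofReal (Real.exp (-l x)) := by
    rw [gaussianReal_of_var_ne_zero _ ht, gaussianReal_of_var_ne_zero _ one_ne_zero,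
      ← withDensity_mul _ (by fun_prop) (by fun_prop)]
    congr 1
    ext x
    simp only [gaussianPDF, Pi.mul_apply]
    rw [← ENNReal.ofReal_mul (gaussianPDFReal_nonneg _ _ _)]
    congr 1
    simp only [gaussianPDFReal, hl]
    have h1 : (Real.sqrt (2 * Real.pi * t))⁻¹ = (Real.sqrt (2 * Real.pi))⁻¹ *
        Real.exp (-(Real.log t / 2)) := by
      rw [Real.sqrt_mul (by positivity), mul_inv, Real.exp_neg, ← Real.log_sqrt ht'.le,
        Real.exp_log (by positivity)]
    rw [h1, mul_assoc (_ * _), ← Real.exp_add,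
      mul_assoc (Real.sqrt (2 * Real.pi))⁻¹, ← Real.exp_add]
    simp only [NNReal.coe_one, mul_one, sub_zero]
    congr 2
    field_simp
    ring
  have hsq : Integrable (fun x : ℝ => x ^ 2) (gaussianReal 0 t) := by
    have := (memLp_id_gaussianReal (μ := 0) (v := t) 2).integrable_sq
    simpa using this
  have hsqv : ∫ x : ℝ, x ^ 2 ∂(gaussianReal 0 t) = t := by
    have h := variance_of_integral_eq_zero (X := fun x : ℝ => x) (μ := gaussianReal 0 t)
      (by fun_prop) (by simp)
    rw [variance_fun_id_gaussianReal] at h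
    simpa using h.symm
  have hp : IsProbabilityMeasure
      ((gaussianReal 0 t).withDensity fun x => ENNReal.ofReal (Real.exp (-l x))) := by
    rw [← hden]; infer_instance
  rw [hden]
  refine GibbsBound.of_withDensity (by fun_prop) ((hsq.mul_const _).sub (integrable_const _)) ?_
  simp only [hl]
  rw [integral_sub (hsq.mul_const _) (integrable_const _), integral_mul_const, hsqv]
  simp
  field_simp
  ring_nf
  rfl

open scoped RealInnerProductSpace

section Multivariate

variable {ι : Type*} [Fintype ι] [DecidableEq ι]

open Matrix in
lemma map_toEuclideanCLM_multivariateGaussian {S : Matrix ι ι ℝ} (hS : S.PosSemidef)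
    (M : Matrix ι ι ℝ) :
    (multivariateGaussian 0 S).map (toEuclideanCLM (𝕜 := ℝ) M) =
      multivariateGaussian 0 (M * S * Mᵀ) := by
  have hS' : (M * S * Mᵀ).PosSemidef := by
    simpa using hS.mul_mul_conjTranspose_same M
  apply Measure.ext_of_charFun
  ext t
  have hadj : charFun ((multivariateGaussian 0 S).map (toEuclideanCLM (𝕜 := ℝ) M)) t =
      charFun (multivariateGaussian 0 S) ((toEuclideanCLM (𝕜 := ℝ) M).adjoint t) := by
    rw [charFun_apply, charFun_apply, integral_map (by fun_prop)
      (Measurable.aestronglyMeasurable (by fun_prop))]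
    simp_rw [ContinuousLinearMap.adjoint_inner_right]
  rw [hadj, charFun_multivariateGaussian hS, charFun_multivariateGaussian hS']
  have h : (toEuclideanCLM (𝕜 := ℝ) M).adjoint = toEuclideanCLM (𝕜 := ℝ) Mᵀ := by
    rw [← ContinuousLinearMap.star_eq_adjoint, ← map_star, Matrix.star_eq_conjTranspose,
      conjTranspose_eq_transpose_of_trivial]
  simp only [h, inner_zero_right, Complex.ofReal_zero, zero_mul, zero_sub]
  congr 4
  simp only [ofLp_toEuclideanCLM, ← mulVec_mulVec]
  rw [dotProduct_mulVec (t.ofLp) M, ← mulVec_transpose]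

lemma map_add_prod_multivariateGaussian {A B : Matrix ι ι ℝ} (hA : A.PosSemidef)
    (hB : B.PosSemidef) :
    ((multivariateGaussian 0 A).prod (multivariateGaussian 0 B)).map (fun q => q.1 + q.2) =
      multivariateGaussian 0 (A + B) := by
  change Measure.conv _ _ = _
  apply Measure.ext_of_charFun
  ext t
  rw [charFun_conv, charFun_multivariateGaussian hA, charFun_multivariateGaussian hB,
    charFun_multivariateGaussian (hA.add hB), ← Complex.exp_add]
  congr 1
  simp [Matrix.add_mulVec, dotProduct_add]
  ring

/-- In an eigenbasis of `S` the coordinates are independent with the eigenvalues as variances. This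
reduces the divergence from the standard Gaussian, which has independent coordinates in every
orthonormal basis, to dimension one. -/
lemma multivariateGaussian_eq_map_pi {S : Matrix ι ι ℝ} (hS : S.PosSemidef) :
    multivariateGaussian 0 S =
      (Measure.pi fun i => gaussianReal 0 (hS.isHermitian.eigenvalues i).toNNReal).map
        (fun x => ∑ i, x i • hS.isHermitian.eigenvectorBasis i) := by
  set b := hS.isHermitian.eigenvectorBasis with hb
  set ev := hS.isHermitian.eigenvalues with hev
  apply Measure.ext_of_charFun
  ext t
  rw [charFun_multivariateGaussian hS, charFun_apply, integral_map
    (Measurable.aemeasurable (by fun_prop)) (Measurable.aestronglyMeasurable (by fun_prop))]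
  simp_rw [sum_inner, Complex.ofReal_sum, Finset.sum_mul, Complex.exp_sum]
  rw [integral_fintype_prod_eq_prod (f := fun i x => Complex.exp (⟪x • b i, t⟫ * Complex.I))]
  simp_rw [real_inner_smul_left, mul_comm _ (⟪_, _⟫), Complex.ofReal_mul, ← charFun_apply_real,
    charFun_gaussianReal, ← Complex.exp_sum]
  congr 1
  have hquad : t.ofLp ⬝ᵥ S.mulVec t.ofLp = ∑ i, ev i * ⟪b i, t⟫ ^ 2 := by
    have h1 : t.ofLp ⬝ᵥ S.mulVec t.ofLp = ⟪t, Matrix.toEuclideanCLM (𝕜 := ℝ) S t⟫ := by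
      rw [Matrix.inner_toEuclideanCLM]
    rw [h1, ← b.sum_inner_mul_inner]
    refine Finset.sum_congr rfl fun i _ => ?_
    have h2 : ⟪b i, Matrix.toEuclideanCLM (𝕜 := ℝ) S t⟫ = ev i * ⟪b i, t⟫ := by
      have h3 : Matrix.toEuclideanCLM (𝕜 := ℝ) S (b i) = ev i • b i := by
        ext j
        have := congrFun (hS.isHermitian.mulVec_eigenvectorBasis i) j
        simpa using this
      have hsa : IsSelfAdjoint (Matrix.toEuclideanCLM (𝕜 := ℝ) S) :=
        IsSelfAdjoint.map (show IsSelfAdjoint S from hS.isHermitian) _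
      rw [← ContinuousLinearMap.adjoint_inner_left, hsa.adjoint_eq, h3, real_inner_smul_left]
    rw [h2, real_inner_comm]
    ring
  rw [hquad]
  simp only [inner_zero_right, Complex.ofReal_zero, zero_mul, zero_sub, mul_zero,
    Complex.ofReal_sum, Finset.sum_div, ← Finset.sum_neg_distrib]
  refine Finset.sum_congr rfl fun i _ => ?_
  have : (((ev i).toNNReal : ℝ) : ℂ) = ((ev i : ℝ) : ℂ) := by
    rw [Real.coe_toNNReal _ (hS.eigenvalues_nonneg i)]
  rw [this]
  push_cast
  ring

end Multivariate

lemma gibbsBound_multivariateGaussian {p : ℕ} {S : Matrix (Fin p) (Fin p) ℝ} (hS : S.PosDef) :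
    GibbsBound (multivariateGaussian 0 S) (multivariateGaussian 0 1)
      ((S.trace - p - Real.log S.det) / 2) := by
  have hH := hS.isHermitian
  have hpos := fun i => hS.eigenvalues_pos i
  have key := (GibbsBound.pi fun i : Fin p => gibbsBound_gaussianReal
    (t := (hH.eigenvalues i).toNNReal) (by simpa using hpos i)).map
    (f := fun x => ∑ i, x i • hH.eigenvectorBasis i) (by fun_prop)
  rw [← multivariateGaussian_eq_map_pi hS.posSemidef, ← stdGaussian_eq_map_pi_orthonormalBasis,
    ← multivariateGaussian_zero_one] at key
  refine key.mono (le_of_eq ?_)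
  rw [hH.trace_eq_sum_eigenvalues, hH.det_eq_prod_eigenvalues]
  simp only [RCLike.ofReal_real_eq_id, id_eq]
  rw [Real.log_prod (fun i _ => (hpos i).ne'), ← Finset.sum_div, Finset.sum_sub_distrib,
    Finset.sum_sub_distrib]
  simp only [Real.coe_toNNReal _ (hpos _).le]
  simp

/-! ### Chain rule for adaptively chosen observations -/

lemma measurable_observe {p : ℕ} (z : Finset (Fin p)) : Measurable (observe z) := by
  refine measurable_pi_lambda _ fun v => ?_
  unfold observe
  split_ifs
  · exact measurable_inl.comp (by fun_prop)
  · exact measurable_const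

lemma measurable_update_pair {E : Type*} [MeasurableSpace E] (i : ℕ) :
    Measurable fun q : (ℕ → E) × E => Function.update q.1 i q.2 := by
  refine measurable_pi_lambda _ fun j => ?_
  by_cases h : j = i
  · subst h; simpa using measurable_snd
  · simp only [Function.update_of_ne h]
    exact (measurable_pi_apply j).comp measurable_fst

/-- Resampling one coordinate does not change a product law. Since the history before round `i`
ignores coordinate `i`, this separates the sample of round `i` from the past. -/
lemma measurePreserving_update_infinitePi {E : Type*} [MeasurableSpace E] (μ : Measure E)
    [IsProbabilityMeasure μ] (i : ℕ) :
    MeasurePreserving (fun q : (ℕ → E) × E => Function.update q.1 i q.2)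
      ((Measure.infinitePi fun _ : ℕ => μ).prod μ) (Measure.infinitePi fun _ : ℕ => μ) where
  measurable := measurable_update_pair i
  map_eq := by
    refine Measure.eq_infinitePi _ fun s t ht => ?_
    classical
    rw [Measure.map_apply (measurable_update_pair i) (MeasurableSet.pi s.countable_toSet fun j _ => ht j)]
    by_cases hi : i ∈ s
    · have : (fun q : (ℕ → E) × E => Function.update q.1 i q.2) ⁻¹' (Set.pi s t) =
          (Set.pi (s.erase i : Finset ℕ) t) ×ˢ t i := by
        ext q
        simp only [Set.mem_preimage, Set.mem_pi, Finset.mem_coe, Set.mem_prod, Finset.mem_erase]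
        constructor
        · intro h
          refine ⟨fun j hj => ?_, ?_⟩
          · simpa [Function.update_of_ne hj.1] using h j hj.2
          · simpa using h i hi
        · rintro ⟨h1, h2⟩ j hj
          by_cases hji : j = i
          · subst hji; simpa using h2
          · simpa [Function.update_of_ne hji] using h1 j ⟨hji, hj⟩
      rw [this, Measure.prod_prod, Measure.infinitePi_pi _ fun j _ => ht j,
        Finset.prod_erase_mul _ _ hi]
    · have : (fun q : (ℕ → E) × E => Function.update q.1 i q.2) ⁻¹' (Set.pi s t) =
          (Set.pi s t) ×ˢ Set.univ := by
        ext q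
        simp only [Set.mem_preimage, Set.mem_pi, Finset.mem_coe, Set.mem_prod, Set.mem_univ,
          and_true]
        refine forall₂_congr fun j hj => ?_
        rw [Function.update_of_ne (by rintro rfl; exact hi hj)]
      rw [this, Measure.prod_prod, Measure.infinitePi_pi _ fun j _ => ht j]
      simp

namespace ActiveLearner

variable {p : ℕ} (A : ActiveLearner p)

lemma history_congr (s : A.Seed) {Y Y' : ℕ → EuclideanSpace ℝ (Fin p)} :
    ∀ i : ℕ, (∀ j < i, Y j = Y' j) → A.history s Y i = A.history s Y' i
  | 0, _ => rfl
  | i + 1, h => by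
    simp only [history]
    rw [history_congr s i fun j hj => h j (by omega), h i (by omega)]

lemma measurable_snoc {X Z : Type*} [MeasurableSpace X] [MeasurableSpace Z] {i : ℕ}
    {f : X → Fin i → Z} {g : X → Z} (hf : Measurable f) (hg : Measurable g) :
    Measurable fun x => (Fin.snoc (α := fun _ => Z) (f x) (g x) : Fin (i + 1) → Z) := by
  refine measurable_pi_lambda _ fun j => ?_
  refine Fin.lastCases ?_ (fun j => ?_) j
  · simpa using hg
  · simp only [Fin.snoc_castSucc]
    exact (measurable_pi_apply j).comp hf

lemma measurable_observe_select {X : Type*} [MeasurableSpace X] {f : X → Finset (Fin p)}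
    {g : X → EuclideanSpace ℝ (Fin p)} (hf : Measurable f) (hg : Measurable g) :
    Measurable fun x => observe (f x) (g x) := by
  have : Measurable fun q : EuclideanSpace ℝ (Fin p) × Finset (Fin p) => observe q.2 q.1 :=
    measurable_from_prod_countable_left fun z => measurable_observe z
  exact this.comp (hg.prodMk hf)

lemma measurable_history : ∀ i : ℕ,
    Measurable fun q : A.Seed × (ℕ → EuclideanSpace ℝ (Fin p)) => A.history q.1 q.2 i
  | 0 => measurable_const
  | i + 1 => by
    simp only [history]
    have ih := measurable_history i
    exact measurable_snoc ih (measurable_observe_select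
      ((A.measurable_select i).comp (measurable_fst.prodMk ih))
      ((measurable_pi_apply i).comp measurable_snd))

lemma measurable_card_select (i : ℕ) :
    Measurable fun q : A.Seed × (ℕ → EuclideanSpace ℝ (Fin p)) =>
      ((A.select i q.1 (A.history q.1 q.2 i)).card : ℝ) :=
  (measurable_of_countable fun z : Finset (Fin p) => (z.card : ℝ)).comp
    ((A.measurable_select i).comp (measurable_fst.prodMk (A.measurable_history i)))

/-- The joint law of the seed and of independent full samples with an arbitrary common law. -/
noncomputable def sampleLaw (μ : Measure (EuclideanSpace ℝ (Fin p))) :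
    Measure (A.Seed × (ℕ → EuclideanSpace ℝ (Fin p))) :=
  A.seedLaw.prod (Measure.infinitePi fun _ : ℕ => μ)

instance (μ : Measure (EuclideanSpace ℝ (Fin p))) [IsProbabilityMeasure μ] :
    IsProbabilityMeasure (A.sampleLaw μ) := by
  unfold sampleLaw; infer_instance

/-- One round appended to a history. -/
noncomputable def extend (i : ℕ) (s : A.Seed) (h : Fin i → Observation p)
    (x : EuclideanSpace ℝ (Fin p)) : Fin (i + 1) → Observation p :=
  Fin.snoc (α := fun _ => Observation p) h (observe (A.select i s h) x)

lemma measurable_extend (i : ℕ) :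
    Measurable fun q : (A.Seed × (Fin i → Observation p)) × EuclideanSpace ℝ (Fin p) =>
      A.extend i q.1.1 q.1.2 q.2 :=
  measurable_snoc (measurable_snd.comp measurable_fst) (measurable_observe_select
    ((A.measurable_select i).comp measurable_fst) measurable_snd)

lemma integral_history_succ (μ : Measure (EuclideanSpace ℝ (Fin p))) [IsProbabilityMeasure μ]
    (i : ℕ) {f : A.Seed × (Fin (i + 1) → Observation p) → ℝ} {K : ℝ} (hf : Measurable f)
    (hK : ∀ q, |f q| ≤ K) :
    ∫ ω, f (ω.1, A.history ω.1 ω.2 (i + 1)) ∂A.sampleLaw μ =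
      ∫ ω, ∫ x, f (ω.1, A.extend i ω.1 (A.history ω.1 ω.2 i) x) ∂μ ∂A.sampleLaw μ := by
  set I := Measure.infinitePi fun _ : ℕ => μ with hI
  have hmp : MeasurePreserving
      (fun q : (A.Seed × (ℕ → EuclideanSpace ℝ (Fin p))) × EuclideanSpace ℝ (Fin p) =>
        (q.1.1, Function.update q.1.2 i q.2)) ((A.sampleLaw μ).prod μ) (A.sampleLaw μ) := by
    have h1 := measurePreserving_prodAssoc A.seedLaw I μ
    have h2 := (MeasurePreserving.id A.seedLaw).prod (measurePreserving_update_infinitePi μ i)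
    exact h2.comp h1
  have hm : Measurable fun ω : A.Seed × (ℕ → EuclideanSpace ℝ (Fin p)) =>
      f (ω.1, A.history ω.1 ω.2 (i + 1)) :=
    hf.comp (measurable_fst.prodMk (A.measurable_history (i + 1)))
  rw [← hmp.map_eq, integral_map hmp.measurable.aemeasurable hm.aestronglyMeasurable]
  have hm' := hm.comp hmp.measurable
  have hint : Integrable (fun q => f ((q.1.1, Function.update q.1.2 i q.2).1,
      A.history (q.1.1, Function.update q.1.2 i q.2).1 (q.1.1, Function.update q.1.2 i q.2).2
        (i + 1))) ((A.sampleLaw μ).prod μ) :=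
    Integrable.of_bound hm'.aestronglyMeasurable K (ae_of_all _ fun q => hK _)
  rw [integral_prod _ hint, hmp.map_eq]
  refine integral_congr_ae (ae_of_all _ fun ω => integral_congr_ae (ae_of_all _ fun x => ?_))
  have : A.history ω.1 (Function.update ω.2 i x) i = A.history ω.1 ω.2 i :=
    A.history_congr ω.1 i fun j hj => Function.update_of_ne hj.ne _ _
  simp only [history, extend, this, Function.update_self]

/-- The information inequality for adaptively chosen observations: if every observation set `z`
carries information at most `c * z.card` about `P` against `Q`, then the first `i` rounds carry
at most `c` times the expected number of observations. -/
theorem integral_log_history_le {P Q : Measure (EuclideanSpace ℝ (Fin p))}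
    [IsProbabilityMeasure P] [IsProbabilityMeasure Q] {c : ℝ}
    (hPQ : ∀ z, GibbsBound (P.map (observe z)) (Q.map (observe z)) (c * z.card)) :
    ∀ (i : ℕ) (g : A.Seed × (Fin i → Observation p) → ℝ) (K : ℝ), Measurable g →
      (∀ q, 1 ≤ g q) → (∀ q, g q ≤ K) →
      ∫ ω, Real.log (g (ω.1, A.history ω.1 ω.2 i)) ∂A.sampleLaw P ≤
        c * ∫ ω, (∑ j ∈ Finset.range i, ((A.select j ω.1 (A.history ω.1 ω.2 j)).card : ℝ))
          ∂A.sampleLaw P + (∫ ω, g (ω.1, A.history ω.1 ω.2 i) ∂A.sampleLaw Q - 1)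
  | 0, g, K, hg, h1, hK => by
    have hg0 : Measurable fun s : A.Seed => g (s, Fin.elim0) :=
      hg.comp (measurable_id.prodMk measurable_const)
    have key : ∀ (R : Measure (EuclideanSpace ℝ (Fin p))) [IsProbabilityMeasure R]
        (f : A.Seed → ℝ), Measurable f →
        ∫ ω, f ω.1 ∂A.sampleLaw R = ∫ s, f s ∂A.seedLaw := by
      intro R _ f hf
      have : (A.sampleLaw R).map Prod.fst = A.seedLaw := by
        simp [sampleLaw, Measure.map_fst_prod]
      rw [← this, integral_map measurable_fst.aemeasurable hf.aestronglyMeasurable]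
    simp only [history, Finset.range_zero, Finset.sum_empty, integral_zero, mul_zero, zero_add]
    rw [key P (fun s => Real.log (g (s, Fin.elim0))) (Real.measurable_log.comp hg0),
      key Q (fun s => g (s, Fin.elim0)) hg0]
    have hi := integrable_of_one_le_le (P := A.seedLaw) hg0 (fun _ => h1 _) fun _ => hK _
    have := integral_mono (μ := A.seedLaw)
      (integrable_log_of_one_le_le hg0 (fun _ => h1 _) fun _ => hK _)
      (hi.sub (integrable_const (1 : ℝ)))
      -- The seed has the same law on both sides. Weakening `log` to `t - 1` here makes the final
      -- bound linear in `g`, ready to be summed over graphs.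
      fun s => Real.log_le_sub_one_of_pos (by linarith [h1 (s, Fin.elim0)])
    refine this.trans (le_of_eq ?_)
    simp only [Pi.sub_apply]
    rw [integral_sub hi (integrable_const _)]
    simp
  | i + 1, g, K, hg, h1, hK => by
    have hge : ∀ s h, Measurable fun x => g (s, A.extend i s h x) := fun s h =>
      hg.comp (measurable_const.prodMk
        ((A.measurable_extend i).comp (measurable_prodMk_left (x := (s, h)))))
    -- Integrating out the last round under `Q` gives a test function of the shorter history, to
    -- which the induction hypothesis applies.
    set g' : A.Seed × (Fin i → Observation p) → ℝ :=
      fun q => ∫ x, g (q.1, A.extend i q.1 q.2 x) ∂Q with hg'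
    have hg'm : Measurable g' := by
      have : Measurable fun q : (A.Seed × (Fin i → Observation p)) × EuclideanSpace ℝ (Fin p) =>
          g (q.1.1, A.extend i q.1.1 q.1.2 q.2) :=
        hg.comp ((measurable_fst.comp measurable_fst).prodMk (A.measurable_extend i))
      exact (this.stronglyMeasurable.integral_prod_right' (ν := Q)).measurable
    have hg'1 : ∀ q, 1 ≤ g' q := fun q => one_le_integral (hge _ _) (fun _ => h1 _) fun _ => hK _
    have hg'K : ∀ q, g' q ≤ K := fun q =>
      integral_le_of_one_le_le (hge _ _) (fun _ => h1 _) fun _ => hK _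
    have ih := integral_log_history_le hPQ i g' K hg'm hg'1 hg'K
    have hK1 : ∀ q, |Real.log (g q)| ≤ Real.log K := fun q => by
      rw [abs_of_nonneg (Real.log_nonneg (h1 q))]
      exact Real.log_le_log (by linarith [h1 q]) (hK q)
    have hK2 : ∀ q, |g q| ≤ K := fun q => by
      rw [abs_of_nonneg (by linarith [h1 q])]; exact hK q
    -- Given seed and history the observed set is fixed, so the bound for a single set applies
    -- conditionally.
    have hstep : ∀ s h, ∫ x, Real.log (g (s, A.extend i s h x)) ∂P ≤
        c * (A.select i s h).card + Real.log (g' (s, h)) := by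
      intro s h
      have hm : Measurable fun o : Observation p =>
          g (s, Fin.snoc (α := fun _ => Observation p) h o) :=
        hg.comp (measurable_const.prodMk (measurable_snoc measurable_const measurable_id))
      have := hPQ (A.select i s h) _ K hm (fun _ => h1 _) fun _ => hK _
      rwa [integral_map (f := fun o => Real.log (g (s, Fin.snoc (α := fun _ => Observation p) h o)))
        (measurable_observe _).aemeasurable (Real.measurable_log.comp hm).aestronglyMeasurable,
        integral_map (measurable_observe _).aemeasurable hm.aestronglyMeasurable] at this
    have hcard : ∀ j, Integrable (fun ω => ((A.select j ω.1 (A.history ω.1 ω.2 j)).card : ℝ))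
        (A.sampleLaw P) := fun j =>
      Integrable.of_bound (A.measurable_card_select j).aestronglyMeasurable p <|
        ae_of_all _ fun ω => by
          simpa using Finset.card_le_univ (A.select j ω.1 (A.history ω.1 ω.2 j))
    have hhist : Measurable fun ω : A.Seed × (ℕ → EuclideanSpace ℝ (Fin p)) =>
        (ω.1, A.history ω.1 ω.2 i) := measurable_fst.prodMk (A.measurable_history i)
    have hlogi : Integrable (fun ω => Real.log (g' (ω.1, A.history ω.1 ω.2 i)))
        (A.sampleLaw P) :=
      integrable_log_of_one_le_le (hg'm.comp hhist) (fun _ => hg'1 _) fun _ => hg'K _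
    have hfirst : Integrable (fun ω : A.Seed × (ℕ → EuclideanSpace ℝ (Fin p)) =>
        ∫ x, Real.log (g (ω.1, A.extend i ω.1 (A.history ω.1 ω.2 i) x)) ∂P) (A.sampleLaw P) := by
      have hm : Measurable fun q : (A.Seed × (ℕ → EuclideanSpace ℝ (Fin p))) ×
          EuclideanSpace ℝ (Fin p) =>
          g (q.1.1, A.extend i q.1.1 (A.history q.1.1 q.1.2 i) q.2) :=
        hg.comp ((measurable_fst.comp measurable_fst).prodMk ((A.measurable_extend i).comp
          ((hhist.comp measurable_fst).prodMk measurable_snd)))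
      exact (integrable_log_of_one_le_le (P := (A.sampleLaw P).prod P) hm (fun _ => h1 _)
        fun _ => hK _).integral_prod_left
    rw [A.integral_history_succ P i (f := fun q => Real.log (g q)) (Real.measurable_log.comp hg) hK1,
      A.integral_history_succ Q i hg hK2]
    simp only [Finset.sum_range_succ]
    rw [integral_add (integrable_finsetSum _ fun j _ => hcard j) (hcard i)]
    calc _ ≤ ∫ ω, (c * ((A.select i ω.1 (A.history ω.1 ω.2 i)).card : ℝ) +
            Real.log (g' (ω.1, A.history ω.1 ω.2 i))) ∂A.sampleLaw P :=
          integral_mono hfirst (((hcard i).const_mul c).add hlogi) fun ω => hstep _ _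
      _ = c * ∫ ω, ((A.select i ω.1 (A.history ω.1 ω.2 i)).card : ℝ) ∂A.sampleLaw P +
            ∫ ω, Real.log (g' (ω.1, A.history ω.1 ω.2 i)) ∂A.sampleLaw P := by
          rw [integral_add ((hcard i).const_mul c) hlogi, integral_const_mul]
      _ ≤ _ := by rw [mul_add]; linarith

end ActiveLearner

/-! ### Information per observed node of a clique -/

/-- With `y = m τ / (1 - τ)` the left side is twice the divergence of a fully observed clique of
size `m`. For `y ≤ 1` both sides are compared with `y² / (1 + y²)`; for `y ≥ 1` already `1 + y ≤ 1 +
y²`. -/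
lemma log_one_add_sub_le {y : ℝ} (hy : 0 ≤ y) :
    Real.log (1 + y) - y / (1 + y) ≤ Real.log (1 + y ^ 2) := by
  rcases le_total y 1 with h | h
  · have h1 := Real.log_le_sub_one_of_pos (x := 1 + y) (by positivity)
    have h2 := Real.one_sub_inv_le_log_of_pos (x := 1 + y ^ 2) (by positivity)
    have h3 : y - y / (1 + y) ≤ 1 - (1 + y ^ 2)⁻¹ := by
      have e1 : y - y / (1 + y) = y ^ 2 / (1 + y) := by field_simp; ring
      have e2 : 1 - (1 + y ^ 2)⁻¹ = y ^ 2 / (1 + y ^ 2) := by field_simp; ring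
      rw [e1, e2]
      gcongr
      nlinarith
    linarith
  · have h1 : Real.log (1 + y) ≤ Real.log (1 + y ^ 2) := by
      apply Real.log_le_log (by positivity); nlinarith
    have : 0 ≤ y / (1 + y) := by positivity
    linarith

/-- The decrease of correlation weight of a clique of size `m` at coupling `τ`. -/
noncomputable def cliqueWeight (τ m : ℝ) : ℝ := τ / (1 - τ + τ * m)

lemma cliqueWeight_nonneg {τ m : ℝ} (h0 : 0 < τ) (h1 : τ < 1) (hm : 0 ≤ m) :
    0 ≤ cliqueWeight τ m := by
  have : 0 < 1 - τ := by linarith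
  unfold cliqueWeight; positivity

lemma cliqueWeight_mul_lt_one {τ m k : ℝ} (h0 : 0 < τ) (h1 : τ < 1) (hm : 0 ≤ m) (hk : k ≤ m) :
    cliqueWeight τ m * k < 1 := by
  have : 0 < 1 - τ := by linarith
  unfold cliqueWeight
  rw [div_mul_eq_mul_div, div_lt_one (by positivity)]
  nlinarith

/-- Concavity of `log` between `1 - X` and `1`, where `X` is the value of `cliqueWeight τ m * k` at
`k = m`, bounds the left side by `k / m` times its value for the full clique. This makes the cost
proportional to the number of observed nodes. -/
lemma neg_sub_log_one_sub_cliqueWeight_le {τ m k : ℝ} (h0 : 0 < τ) (h1 : τ < 1) (hm : 0 < m)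
    (hk0 : 0 ≤ k) (hk : k ≤ m) :
    -(cliqueWeight τ m * k) - Real.log (1 - cliqueWeight τ m * k) ≤
      k / m * Real.log (1 + (m * (τ / (1 - τ))) ^ 2) := by
  have hτ : 0 < 1 - τ := by linarith
  set y := m * (τ / (1 - τ)) with hy
  have hy0 : 0 ≤ y := by positivity
  set X := cliqueWeight τ m * m with hX
  have hX1 : X < 1 := cliqueWeight_mul_lt_one h0 h1 hm.le le_rfl
  have hXy : X = y / (1 + y) := by
    rw [hX, hy, cliqueWeight]; field_simp
  have hXy' : 1 - X = (1 + y)⁻¹ := by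
    rw [hXy]; field_simp; ring
  set t := k / m with ht
  have ht0 : 0 ≤ t := by positivity
  have ht1 : t ≤ 1 := by rw [ht, div_le_one hm]; exact hk
  have hk' : cliqueWeight τ m * k = t * X := by
    rw [hX, ht]; field_simp
  have hconc := strictConcaveOn_log_Ioi.concaveOn.2 (Set.mem_Ioi.2 (show (0 : ℝ) < 1 - X by linarith))
    (Set.mem_Ioi.2 one_pos) ht0 (sub_nonneg.2 ht1) (by ring)
  simp only [smul_eq_mul, Real.log_one, mul_zero, add_zero] at hconc
  have e : t * (1 - X) + (1 - t) * 1 = 1 - t * X := by ring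
  rw [e] at hconc
  have hlog : Real.log (1 - X) = -Real.log (1 + y) := by rw [hXy', Real.log_inv]
  rw [hk']
  have hmain := mul_le_mul_of_nonneg_left (log_one_add_sub_le hy0) ht0
  rw [hlog] at hconc
  rw [← hXy] at hmain
  nlinarith

/-! ### Block matrices indexed by labels -/

section BlockMatrix

variable {ι J : Type*} [DecidableEq ι] [DecidableEq J]

/-- The matrix with entry `a j` at the pairs of indices of `z` that both have label `j`. -/
def blockMatrix (c : ι → J) (a : J → ℝ) (z : Finset ι) : Matrix ι ι ℝ :=
  Matrix.of fun u w => if u ∈ z ∧ w ∈ z ∧ c u = c w then a (c u) else 0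

lemma blockMatrix_transpose (c : ι → J) (a : J → ℝ) (z : Finset ι) :
    (blockMatrix c a z).transpose = blockMatrix c a z := by
  ext u w
  simp only [blockMatrix, Matrix.transpose_apply, Matrix.of_apply]
  by_cases h1 : u ∈ z <;> by_cases h2 : w ∈ z <;> by_cases h3 : c u = c w <;>
    simp [h1, h2, h3, eq_comm]

section

variable [Fintype ι]

lemma block_mul_eq_diagonal (c : ι → J) (a : J → ℝ) (z : Finset ι) :
    (Matrix.of fun j u => if u ∈ z ∧ c u = j then 1 else 0 : Matrix J ι ℝ) *
      (Matrix.of fun u j => if u ∈ z ∧ c u = j then a j else 0 : Matrix ι J ℝ) =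
      Matrix.diagonal fun j => a j * ((z.filter fun u => c u = j).card : ℝ) := by
  ext i j
  simp only [Matrix.of_apply, Matrix.mul_apply]
  by_cases h : i = j
  · subst h
    rw [Matrix.diagonal_apply_eq, Finset.card_filter, Nat.cast_sum, Finset.mul_sum,
      ← Finset.sum_subset (Finset.subset_univ z)]
    · refine Finset.sum_congr rfl fun u hu => ?_
      by_cases h3 : c u = i <;> simp [hu, h3]
    · intro u _ hu
      simp [hu]
  · rw [Matrix.diagonal_apply_ne _ h]
    refine Finset.sum_eq_zero fun u _ => ?_
    by_cases h1 : c u = i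
    · have : c u ≠ j := fun h2 => h (h1.symm.trans h2)
      simp [this]
    · simp [h1]

end

variable [Fintype J]

lemma blockMatrix_eq_mul (c : ι → J) (a : J → ℝ) (z : Finset ι) :
    blockMatrix c a z = (Matrix.of fun u j => if u ∈ z ∧ c u = j then a j else 0 : Matrix ι J ℝ) *
      (Matrix.of fun j u => if u ∈ z ∧ c u = j then 1 else 0 : Matrix J ι ℝ) := by
  ext u w
  simp only [blockMatrix, Matrix.of_apply, Matrix.mul_apply]
  rw [Finset.sum_eq_single (c u)]
  · by_cases h1 : u ∈ z <;> by_cases h2 : w ∈ z <;> by_cases h3 : c u = c w <;>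
      simp [h1, h2, h3, eq_comm]
  · intro j _ hj
    simp [Ne.symm hj]
  · simp

variable [Fintype ι]

/-- The block matrix factors through the label space, and `det (1 - A B) = det (1 - B A)` moves the
determinant to a diagonal matrix indexed by labels. -/
lemma det_one_sub_blockMatrix (c : ι → J) (a : J → ℝ) (z : Finset ι) :
    (1 - blockMatrix c a z).det = ∏ j, (1 - a j * ((z.filter fun u => c u = j).card : ℝ)) := by
  rw [blockMatrix_eq_mul, Matrix.det_one_sub_mul_comm, block_mul_eq_diagonal,
    ← Matrix.diagonal_one, Matrix.diagonal_sub, Matrix.det_diagonal]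

lemma trace_blockMatrix (c : ι → J) (a : J → ℝ) (z : Finset ι) :
    (blockMatrix c a z).trace = ∑ j, a j * ((z.filter fun u => c u = j).card : ℝ) := by
  rw [blockMatrix_eq_mul, Matrix.trace_mul_comm, block_mul_eq_diagonal, Matrix.trace_diagonal]

lemma dotProduct_blockMatrix_mulVec (c : ι → J) (a : J → ℝ) (z : Finset ι) (x : ι → ℝ) :
    x ⬝ᵥ (blockMatrix c a z).mulVec x = ∑ j, a j * (∑ u ∈ z.filter fun u => c u = j, x u) ^ 2 := by
  rw [blockMatrix_eq_mul, ← Matrix.mulVec_mulVec, Matrix.dotProduct_mulVec]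
  refine Finset.sum_congr rfl fun j _ => ?_
  have h1 : Matrix.vecMul x (Matrix.of fun u j => if u ∈ z ∧ c u = j then a j else 0) j =
      a j * ∑ u ∈ z.filter fun u => c u = j, x u := by
    simp only [Matrix.vecMul, dotProduct, Matrix.of_apply]
    rw [Finset.mul_sum, ← Finset.sum_subset (Finset.subset_univ (z.filter fun u => c u = j))]
    · refine Finset.sum_congr rfl fun u hu => ?_
      rw [if_pos (Finset.mem_filter.1 hu), mul_comm]
    · intro u _ hu
      rw [if_neg (fun h => hu (Finset.mem_filter.2 h)), mul_zero]
  have h2 : Matrix.mulVec (Matrix.of fun j u => if u ∈ z ∧ c u = j then (1 : ℝ) else 0) x j =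
      ∑ u ∈ z.filter fun u => c u = j, x u := by
    simp only [Matrix.mulVec, dotProduct, Matrix.of_apply]
    rw [← Finset.sum_subset (Finset.subset_univ (z.filter fun u => c u = j))]
    · refine Finset.sum_congr rfl fun u hu => ?_
      rw [if_pos (Finset.mem_filter.1 hu), one_mul]
    · intro u _ hu
      rw [if_neg (fun h => hu (Finset.mem_filter.2 h)), zero_mul]
  rw [h1, h2]
  ring

/-- Cauchy–Schwarz in each block bounds the quadratic form of the block matrix by weights below 1
times the squares of the coordinates. -/
lemma posDef_one_sub_blockMatrix {c : ι → J} {a : J → ℝ} {z : Finset ι} (ha : ∀ j, 0 ≤ a j)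
    (ha1 : ∀ j, a j * ((z.filter fun u => c u = j).card : ℝ) < 1) :
    (1 - blockMatrix c a z).PosDef := by
  refine Matrix.PosDef.of_dotProduct_mulVec_pos ?_ fun x hx => ?_
  · rw [Matrix.IsHermitian, Matrix.conjTranspose_eq_transpose_of_trivial, Matrix.transpose_sub,
      blockMatrix_transpose, Matrix.transpose_one]
  · rw [star_trivial, Matrix.sub_mulVec, Matrix.one_mulVec, dotProduct_sub,
      dotProduct_blockMatrix_mulVec, sub_pos]
    set κ : J → ℝ := fun j => a j * ((z.filter fun u => c u = j).card : ℝ) with hκ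
    have hκ0 : ∀ j, 0 ≤ κ j := fun j => mul_nonneg (ha j) (Nat.cast_nonneg _)
    obtain ⟨v, hv⟩ : ∃ v, x v ≠ 0 := by
      by_contra! h
      exact hx (funext h)
    calc ∑ j, a j * (∑ u ∈ z.filter fun u => c u = j, x u) ^ 2
        ≤ ∑ j, κ j * ∑ u ∈ Finset.univ.filter fun u => c u = j, x u ^ 2 := by
          refine Finset.sum_le_sum fun j _ => ?_
          rw [hκ, mul_assoc]
          refine mul_le_mul_of_nonneg_left (sq_sum_le_card_mul_sum_sq.trans ?_) (ha j)
          refine mul_le_mul_of_nonneg_left ?_ (Nat.cast_nonneg _)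
          exact Finset.sum_le_sum_of_subset_of_nonneg
            (Finset.filter_subset_filter _ (Finset.subset_univ z)) fun _ _ _ => sq_nonneg _
      _ = ∑ u, κ (c u) * x u ^ 2 := by
          rw [← Finset.sum_fiberwise Finset.univ c]
          refine Finset.sum_congr rfl fun j _ => ?_
          rw [Finset.mul_sum]
          refine Finset.sum_congr rfl fun u hu => ?_
          rw [(Finset.mem_filter.1 hu).2]
      _ < ∑ u, x u ^ 2 := by
          refine Finset.sum_lt_sum (fun u _ => ?_) ⟨v, Finset.mem_univ _, ?_⟩
          · nlinarith [sq_nonneg (x u), ha1 (c u)]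
          · have : 0 < x v ^ 2 := by positivity
            nlinarith [ha1 (c v)]
      _ = x ⬝ᵥ x := by simp [dotProduct, sq]

end BlockMatrix

/-! ### The clique model and its reference law -/

lemma observe_congr {p : ℕ} {z : Finset (Fin p)} {x y : EuclideanSpace ℝ (Fin p)}
    (h : ∀ v ∈ z, x v = y v) : observe z x = observe z y := by
  funext v
  unfold observe
  split_ifs with hv
  · rw [h v hv]
  · rfl

/-- The graph in which distinct nodes are adjacent exactly when they carry the same label. -/
def cliqueGraph {V J : Type*} (c : V → J) : SimpleGraph V where
  Adj u v := u ≠ v ∧ c u = c v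
  symm := ⟨fun _ _ h => ⟨h.1.symm, h.2.symm⟩⟩
  loopless := ⟨fun _ h => h.1 rfl⟩

section Model

variable {p : ℕ} {J : Type*} [DecidableEq J]

/-- The number of nodes with a given label. -/
def fiberCard {V J : Type*} [Fintype V] [DecidableEq J] (c : V → J) (j : J) : ℕ :=
  (Finset.univ.filter fun u => c u = j).card

/-- The covariance matrix of the Gaussian graphical model on `cliqueGraph c`. -/
noncomputable def cliqueCovariance (τ : ℝ) (c : Fin p → J) : Matrix (Fin p) (Fin p) ℝ :=
  (1 - τ)⁻¹ • (1 - blockMatrix c (fun j => cliqueWeight τ (fiberCard c j)) Finset.univ)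

lemma card_filter_le_fiberCard (c : Fin p → J) (z : Finset (Fin p)) (j : J) :
    (z.filter fun u => c u = j).card ≤ fiberCard c j :=
  Finset.card_le_card (Finset.filter_subset_filter _ (Finset.subset_univ z))

/-- Sherman–Morrison on each clique, where the precision matrix is a multiple of the identity plus a
matrix of rank one. -/
lemma inv_precisionMatrix_cliqueGraph {τ : ℝ} (h0 : 0 < τ) (h1 : τ < 1) (c : Fin p → J) :
    (precisionMatrix τ (cliqueGraph c))⁻¹ = cliqueCovariance τ c := by
  have hτ : 0 < 1 - τ := by linarith
  apply Matrix.inv_eq_right_inv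
  have hprec : precisionMatrix τ (cliqueGraph c) =
      (1 - τ) • 1 + τ • blockMatrix c 1 Finset.univ := by
    ext u w
    by_cases huw : u = w
    · subst huw; simp [precisionMatrix, blockMatrix]
    · by_cases hc : c u = c w <;> simp [precisionMatrix, blockMatrix, cliqueGraph, huw, hc]
  have hmul : blockMatrix c 1 Finset.univ *
      blockMatrix c (fun j => cliqueWeight τ (fiberCard c j)) Finset.univ =
      blockMatrix c (fun j => fiberCard c j * cliqueWeight τ (fiberCard c j)) Finset.univ := by
    ext u w
    simp only [blockMatrix, Matrix.mul_apply, Matrix.of_apply, Finset.mem_univ, true_and,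
      Pi.one_apply]
    by_cases hc : c u = c w
    · rw [if_pos hc]
      have : ∀ x, (if c u = c x then (1 : ℝ) else 0) *
          (if c x = c w then cliqueWeight τ (fiberCard c (c x)) else 0) =
          if c x = c u then cliqueWeight τ (fiberCard c (c u)) else 0 := by
        intro x
        by_cases hx : c x = c u
        · simp [hx, hc]
        · simp [hx, Ne.symm hx]
      simp_rw [this]
      rw [← Finset.sum_filter, Finset.sum_const, nsmul_eq_mul]
      rfl
    · rw [if_neg hc]
      refine Finset.sum_eq_zero fun x _ => ?_
      by_cases hx : c u = c x
      · rw [if_neg (fun h => hc (hx.trans h)), mul_zero]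
      · rw [if_neg hx, zero_mul]
  rw [hprec, cliqueCovariance, Matrix.mul_smul, add_mul, mul_sub, mul_sub, Matrix.smul_mul,
    Matrix.smul_mul, Matrix.smul_mul, Matrix.smul_mul, hmul]
  simp only [one_mul, mul_one]
  ext u w
  simp only [Matrix.smul_apply, Matrix.add_apply, Matrix.sub_apply, blockMatrix, Matrix.of_apply,
    Finset.mem_univ, true_and, Pi.one_apply, smul_eq_mul]
  have hn : 0 < 1 - τ + τ * (fiberCard c (c u) : ℝ) := by positivity
  split_ifs with h
  · unfold cliqueWeight
    field_simp
    ring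
  · field_simp
    ring

/-- The `0`-`1` diagonal matrix of a coordinate projection. -/
def coordProj (q : Fin p → Prop) [DecidablePred q] : Matrix (Fin p) (Fin p) ℝ :=
  Matrix.diagonal fun u => if q u then 1 else 0

lemma coordProj_transpose (q : Fin p → Prop) [DecidablePred q] :
    (coordProj q).transpose = coordProj q := Matrix.diagonal_transpose _

lemma coordProj_mul_mul_apply (q : Fin p → Prop) [DecidablePred q]
    (M : Matrix (Fin p) (Fin p) ℝ) (u w : Fin p) :
    (coordProj q * M * coordProj q) u w = if q u ∧ q w then M u w else 0 := by
  rw [coordProj, Matrix.mul_diagonal, Matrix.diagonal_mul]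
  by_cases h1 : q u <;> by_cases h2 : q w <;> simp [h1, h2]

lemma toEuclideanCLM_coordProj_apply (q : Fin p → Prop) [DecidablePred q]
    (x : EuclideanSpace ℝ (Fin p)) (v : Fin p) :
    Matrix.toEuclideanCLM (𝕜 := ℝ) (coordProj q) x v = if q v then x v else 0 := by
  rw [Matrix.ofLp_toEuclideanCLM, coordProj, Matrix.mulVec_diagonal]
  split_ifs <;> simp

/-- The covariance matrix of the nodes whose label is not in `B`. -/
noncomputable def residualCovariance (τ : ℝ) (B : Finset J) (c : Fin p → J) :
    Matrix (Fin p) (Fin p) ℝ :=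
  coordProj (fun u => c u ∉ B) * cliqueCovariance τ c * coordProj (fun u => c u ∉ B)

/-- The reference law: independent coordinates on the nodes with label in `B`, and the law of the
model on the other nodes. -/
noncomputable def referenceLaw (τ : ℝ) (B : Finset J) (c : Fin p → J) :
    Measure (EuclideanSpace ℝ (Fin p)) :=
  ((multivariateGaussian 0 1).prod (multivariateGaussian 0 (residualCovariance τ B c))).map
    fun q => Matrix.toEuclideanCLM (𝕜 := ℝ)
      (Real.sqrt (1 - τ)⁻¹ • coordProj fun u => c u ∈ B) q.1 + q.2

instance (τ : ℝ) (B : Finset J) (c : Fin p → J) : IsProbabilityMeasure (referenceLaw τ B c) := by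
  unfold referenceLaw
  exact Measure.isProbabilityMeasure_map (Measurable.aemeasurable (by fun_prop))

/-- The variance `(1 - τ)⁻¹` on the nodes of `B` does not depend on clique sizes, so the arrangement
of labels inside `B` leaves no trace in the reference law. -/
lemma referenceLaw_congr {τ : ℝ} {B : Finset J} {c c' : Fin p → J}
    (hcard : ∀ j, fiberCard c j = fiberCard c' j) (hB : ∀ u, c u ∈ B ↔ c' u ∈ B)
    (hc : ∀ u, c u ∉ B → c u = c' u) : referenceLaw τ B c = referenceLaw τ B c' := by
  have hres : residualCovariance τ B c = residualCovariance τ B c' := by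
    ext u w
    rw [residualCovariance, residualCovariance, coordProj_mul_mul_apply, coordProj_mul_mul_apply]
    simp only [hB]
    split_ifs with h
    · have hu := hc u (mt (hB u).1 h.1)
      have hw := hc w (mt (hB w).1 h.2)
      simp only [cliqueCovariance, Matrix.smul_apply, Matrix.sub_apply, blockMatrix,
        Matrix.of_apply, hcard, hu, hw]
    · rfl
  have hproj : (coordProj fun u => c u ∈ B) = coordProj fun u => c' u ∈ B := by
    simp only [coordProj, hB]
  rw [referenceLaw, referenceLaw, hres, hproj]

/-- The weights of the cliques in `B`, and zero on the others. -/
noncomputable def restrictedWeight (τ : ℝ) (B : Finset J) (c : Fin p → J) (j : J) : ℝ :=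
  if j ∈ B then cliqueWeight τ (fiberCard c j) else 0

variable [Fintype J]

lemma posDef_cliqueCovariance {τ : ℝ} (h0 : 0 < τ) (h1 : τ < 1) (c : Fin p → J) :
    (cliqueCovariance τ c).PosDef :=
  (posDef_one_sub_blockMatrix (fun _ => cliqueWeight_nonneg h0 h1 (Nat.cast_nonneg _))
    fun _ => cliqueWeight_mul_lt_one h0 h1 (Nat.cast_nonneg _) le_rfl).smul
    (inv_pos.2 (by linarith))

lemma posSemidef_residualCovariance {τ : ℝ} (h0 : 0 < τ) (h1 : τ < 1) (B : Finset J)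
    (c : Fin p → J) : (residualCovariance τ B c).PosSemidef := by
  have := (posDef_cliqueCovariance h0 h1 c).posSemidef.mul_mul_conjTranspose_same
    (coordProj fun u => c u ∉ B)
  rwa [Matrix.conjTranspose_eq_transpose_of_trivial, coordProj_transpose] at this

lemma posDef_observedCovariance {τ : ℝ} (h0 : 0 < τ) (h1 : τ < 1) (B : Finset J) (c : Fin p → J)
    (z : Finset (Fin p)) : (1 - blockMatrix c (restrictedWeight τ B c) z).PosDef := by
  refine posDef_one_sub_blockMatrix (fun j => ?_) fun j => ?_
  · unfold restrictedWeight
    split_ifs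
    · exact cliqueWeight_nonneg h0 h1 (Nat.cast_nonneg _)
    · exact le_rfl
  · unfold restrictedWeight
    split_ifs
    · exact cliqueWeight_mul_lt_one h0 h1 (Nat.cast_nonneg _)
        (Nat.cast_le.2 (card_filter_le_fiberCard c z j))
    · simp

/-- This writes the observed model as an image under the same map that produces the observed
reference law, with the identity covariance of the first factor replaced. Hence the divergence is at
most that between the first factors. -/
lemma gaussianModel_map_observe {τ : ℝ} (h0 : 0 < τ) (h1 : τ < 1) (B : Finset J) (c : Fin p → J)
    (z : Finset (Fin p)) :
    (gaussianModel τ (cliqueGraph c)).map (observe z) =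
      ((multivariateGaussian 0 (1 - blockMatrix c (restrictedWeight τ B c) z)).prod
        (multivariateGaussian 0 (residualCovariance τ B c))).map
        fun q => observe z (Matrix.toEuclideanCLM (𝕜 := ℝ)
          (Real.sqrt (1 - τ)⁻¹ • coordProj fun u => c u ∈ B) q.1 + q.2) := by
  have hτ : 0 < 1 - τ := by linarith
  set S := cliqueCovariance τ c with hS
  have hSp := (posDef_cliqueCovariance h0 h1 c).posSemidef
  set A := 1 - blockMatrix c (restrictedWeight τ B c) z with hA
  have hAp := (posDef_observedCovariance h0 h1 B c z).posSemidef
  set C := residualCovariance τ B c with hC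
  have hCp := posSemidef_residualCovariance h0 h1 B c
  set D := coordProj fun u => u ∈ z with hD
  set N := Real.sqrt (1 - τ)⁻¹ • coordProj fun u => u ∈ z ∧ c u ∈ B with hN
  -- There are no cross terms: a node with label in `B` and one with label outside lie in different
  -- cliques and are uncorrelated.
  have hsplit : D * S * D.transpose = N * A * N.transpose + D * C * D.transpose := by
    rw [hN, Matrix.transpose_smul, Matrix.smul_mul, Matrix.mul_smul, Matrix.smul_mul, smul_smul,
      Real.mul_self_sqrt (by positivity), hD, coordProj_transpose, coordProj_transpose]
    ext u w
    rw [Matrix.add_apply, Matrix.smul_apply, coordProj_mul_mul_apply, coordProj_mul_mul_apply,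
      coordProj_mul_mul_apply, hC, residualCovariance, coordProj_mul_mul_apply, hS, hA,
      cliqueCovariance]
    simp only [Matrix.smul_apply, Matrix.sub_apply, blockMatrix, Matrix.of_apply, Finset.mem_univ,
      true_and, smul_eq_mul, restrictedWeight]
    by_cases hu : u ∈ z <;> by_cases hw : w ∈ z <;> simp only [hu, hw, true_and, and_true,
      false_and, and_false, if_false, if_true, mul_zero, add_zero]
    by_cases hcu : c u ∈ B <;> by_cases hcw : c w ∈ B
    · simp [hcu, hcw]
    · have : c u ≠ c w := fun h => hcw (h ▸ hcu)
      have huw : u ≠ w := fun h => this (h ▸ rfl)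
      simp [hcu, hcw, this, huw]
    · have : c u ≠ c w := fun h => hcu (h ▸ hcw)
      have huw : u ≠ w := fun h => this (h ▸ rfl)
      simp [hcu, hcw, this, huw]
    · simp [hcu, hcw]
  have hobs : observe z = observe z ∘ Matrix.toEuclideanCLM (𝕜 := ℝ) D := by
    funext x
    refine observe_congr fun v hv => ?_
    rw [hD, toEuclideanCLM_coordProj_apply, if_pos hv]
  have hNm : (N * A * N.transpose).PosSemidef := by
    simpa using hAp.mul_mul_conjTranspose_same N
  have hDm : (D * C * D.transpose).PosSemidef := by
    simpa using hCp.mul_mul_conjTranspose_same D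
  have hmodel : (multivariateGaussian 0 S).map (observe z) =
      ((multivariateGaussian 0 S).map (Matrix.toEuclideanCLM (𝕜 := ℝ) D)).map (observe z) := by
    rw [Measure.map_map (measurable_observe z) (by fun_prop), ← hobs]
  rw [gaussianModel, inv_precisionMatrix_cliqueGraph h0 h1, hmodel,
    map_toEuclideanCLM_multivariateGaussian hSp, hsplit,
    ← map_add_prod_multivariateGaussian hNm hDm,
    ← map_toEuclideanCLM_multivariateGaussian hAp, ← map_toEuclideanCLM_multivariateGaussian hCp,
    Measure.map_prod_map _ _ (by fun_prop) (by fun_prop),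
    Measure.map_map (measurable_observe z) (by fun_prop),
    Measure.map_map ((measurable_observe z).comp (by fun_prop)) (by fun_prop)]
  congr 1
  funext q
  refine observe_congr fun v hv => ?_
  simp only [Prod.map_fst, Prod.map_snd, hN, hD, map_smul, PiLp.add_apply,
    smul_apply, PiLp.smul_apply,
    toEuclideanCLM_coordProj_apply, hv, true_and, if_true]

theorem gibbsBound_observe {τ : ℝ} (h0 : 0 < τ) (h1 : τ < 1) (B : Finset J) (c : Fin p → J)
    {s M : ℕ} (hs : 0 < s) (hsB : ∀ j ∈ B, s ≤ fiberCard c j) (hM : ∀ j ∈ B, fiberCard c j ≤ M)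
    (z : Finset (Fin p)) :
    GibbsBound ((gaussianModel τ (cliqueGraph c)).map (observe z))
      ((referenceLaw τ B c).map (observe z))
      (Real.log (1 + (M * (τ / (1 - τ))) ^ 2) / (2 * s) * z.card) := by
  have hτ : 0 < 1 - τ := by linarith
  have hm : Measurable fun q : EuclideanSpace ℝ (Fin p) × EuclideanSpace ℝ (Fin p) =>
      Matrix.toEuclideanCLM (𝕜 := ℝ)
        (Real.sqrt (1 - τ)⁻¹ • coordProj fun u => c u ∈ B) q.1 + q.2 := by fun_prop
  rw [gaussianModel_map_observe h0 h1 B c z, referenceLaw,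
    Measure.map_map (measurable_observe z) hm]
  refine (((gibbsBound_multivariateGaussian (posDef_observedCovariance h0 h1 B c z)).prod
    (GibbsBound.refl _)).map ((measurable_observe z).comp hm)).mono ?_
  rw [Matrix.trace_sub, Matrix.trace_one, trace_blockMatrix, det_one_sub_blockMatrix, add_zero,
    Fintype.card_fin]
  have hlt : ∀ j, restrictedWeight τ B c j * ((z.filter fun u => c u = j).card : ℝ) < 1 := by
    intro j
    unfold restrictedWeight
    split_ifs
    · exact cliqueWeight_mul_lt_one h0 h1 (Nat.cast_nonneg _)
        (Nat.cast_le.2 (card_filter_le_fiberCard c z j))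
    · simp
  rw [Real.log_prod fun j _ => (sub_pos.2 (hlt j)).ne']
  set Λ := Real.log (1 + ((M : ℝ) * (τ / (1 - τ))) ^ 2) with hΛ
  have hΛ0 : 0 ≤ Λ := Real.log_nonneg (by nlinarith [sq_nonneg ((M : ℝ) * (τ / (1 - τ)))])
  have hcard : (z.card : ℝ) = ∑ j, ((z.filter fun u => c u = j).card : ℝ) := by
    rw [← Nat.cast_sum, ← Finset.card_eq_sum_card_fiberwise fun _ _ => Finset.mem_univ _]
  -- Twice the divergence splits over the labels; a clique in `B` contributes at most `Λ / s` per
  -- observed node, one outside `B` contributes nothing.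
  have hj : ∀ j, -(restrictedWeight τ B c j * ((z.filter fun u => c u = j).card : ℝ)) -
      Real.log (1 - restrictedWeight τ B c j * ((z.filter fun u => c u = j).card : ℝ)) ≤
      Λ / s * ((z.filter fun u => c u = j).card : ℝ) := by
    intro j
    by_cases hB : j ∈ B
    · have hf : (0 : ℝ) < fiberCard c j := Nat.cast_pos.2 (hs.trans_le (hsB j hB))
      have hs' : (0 : ℝ) < s := Nat.cast_pos.2 hs
      have hk : ((z.filter fun u => c u = j).card : ℝ) ≤ fiberCard c j :=
        Nat.cast_le.2 (card_filter_le_fiberCard c z j)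
      simp only [restrictedWeight, if_pos hB]
      refine (neg_sub_log_one_sub_cliqueWeight_le h0 h1 hf (Nat.cast_nonneg _) hk).trans ?_
      rw [div_mul_eq_mul_div Λ, mul_comm Λ, mul_div_right_comm]
      have hlog : Real.log (1 + ((fiberCard c j : ℝ) * (τ / (1 - τ))) ^ 2) ≤ Λ := by
        refine Real.log_le_log (by positivity) ?_
        gcongr
        exact hM j hB
      have hcoef : ((z.filter fun u => c u = j).card : ℝ) / fiberCard c j ≤
          ((z.filter fun u => c u = j).card : ℝ) / s := by
        gcongr
        exact hsB j hB
      exact mul_le_mul hcoef hlog (Real.log_nonneg (by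
        nlinarith [sq_nonneg ((fiberCard c j : ℝ) * (τ / (1 - τ)))])) (by positivity)
    · simp only [restrictedWeight, if_neg hB]
      simp
      positivity
  have hsum := Finset.sum_le_sum fun j (_ : j ∈ Finset.univ) => hj j
  rw [Finset.sum_sub_distrib, Finset.sum_neg_distrib, ← Finset.mul_sum, ← hcard] at hsum
  have e : Λ / (2 * s) * (z.card : ℝ) = Λ / s * z.card / 2 := by
    field_simp
  rw [e]
  linarith

end Model

/-! ### Success probability under model and reference -/

lemma measurableSet_singleton_simpleGraph {V : Type*} [Countable V] (G : SimpleGraph V) :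
    MeasurableSet ({G} : Set (SimpleGraph V)) := by
  have h := SimpleGraph.measurable_adj (measurableSet_singleton G.Adj)
  convert h using 1
  ext H
  exact (SimpleGraph.adj_injective.eq_iff (a := H) (b := G)).symm

namespace ActiveLearner

variable {p : ℕ} (A : ActiveLearner p)

/-- The event that the estimate is `G`. -/
def estimateEvent (G : SimpleGraph (Fin p)) :
    Set (A.Seed × (ℕ → EuclideanSpace ℝ (Fin p))) :=
  {ω | A.estimate ω.1 (A.history ω.1 ω.2 A.rounds) = G}

lemma measurable_finalEstimate :
    Measurable fun ω : A.Seed × (ℕ → EuclideanSpace ℝ (Fin p)) =>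
      A.estimate ω.1 (A.history ω.1 ω.2 A.rounds) :=
  A.measurable_estimate.comp (measurable_fst.prodMk (A.measurable_history A.rounds))

lemma measurableSet_estimateEvent (G : SimpleGraph (Fin p)) :
    MeasurableSet (A.estimateEvent G) :=
  A.measurable_finalEstimate (measurableSet_singleton_simpleGraph G)

lemma errorProb_eq (τ : ℝ) (G : SimpleGraph (Fin p)) :
    A.errorProb τ G = 1 - (A.sampleLaw (gaussianModel τ G)).real (A.estimateEvent G) := by
  rw [← probReal_compl_eq_one_sub (A.measurableSet_estimateEvent G)]
  rfl

/-- The chain rule is tested on the function equal to `κ` where the estimate is `G` and to 1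
elsewhere. -/
lemma success_mul_log_le {P Q : Measure (EuclideanSpace ℝ (Fin p))} [IsProbabilityMeasure P]
    [IsProbabilityMeasure Q] {c : ℝ} (hc : 0 ≤ c)
    (hPQ : ∀ z, GibbsBound (P.map (observe z)) (Q.map (observe z)) (c * z.card)) {n : ℕ}
    (hn : ∀ᵐ ω ∂A.sampleLaw P, A.totalObservations ω.1 ω.2 ≤ n) {κ : ℝ} (hκ : 1 ≤ κ)
    (G : SimpleGraph (Fin p)) :
    (A.sampleLaw P).real (A.estimateEvent G) * Real.log κ ≤
      c * n + (κ - 1) * (A.sampleLaw Q).real (A.estimateEvent G) := by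
  classical
  set g : A.Seed × (Fin A.rounds → Observation p) → ℝ :=
    fun q => if A.estimate q.1 q.2 = G then κ else 1 with hg
  have hgm : Measurable g := Measurable.ite
    (A.measurable_estimate (measurableSet_singleton_simpleGraph G)) measurable_const measurable_const
  have key := A.integral_log_history_le hPQ A.rounds g κ hgm
    (fun q => by simp only [hg]; split_ifs <;> simp [hκ])
    (fun q => by simp only [hg]; split_ifs <;> simp [hκ])
  have h1 : ∫ ω, Real.log (g (ω.1, A.history ω.1 ω.2 A.rounds)) ∂A.sampleLaw P =
      (A.sampleLaw P).real (A.estimateEvent G) * Real.log κ := by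
    have : ∀ ω : A.Seed × (ℕ → EuclideanSpace ℝ (Fin p)),
        Real.log (g (ω.1, A.history ω.1 ω.2 A.rounds)) =
          (A.estimateEvent G).indicator (fun _ => Real.log κ) ω := by
      intro ω
      by_cases h : A.estimate ω.1 (A.history ω.1 ω.2 A.rounds) = G <;>
        simp [hg, estimateEvent, h]
    simp_rw [this]
    rw [integral_indicator_const _ (A.measurableSet_estimateEvent G), smul_eq_mul]
  have h2 : ∫ ω, g (ω.1, A.history ω.1 ω.2 A.rounds) ∂A.sampleLaw Q - 1 =
      (κ - 1) * (A.sampleLaw Q).real (A.estimateEvent G) := by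
    have : ∀ ω : A.Seed × (ℕ → EuclideanSpace ℝ (Fin p)),
        g (ω.1, A.history ω.1 ω.2 A.rounds) =
          (A.estimateEvent G).indicator (fun _ => κ - 1) ω + 1 := by
      intro ω
      by_cases h : A.estimate ω.1 (A.history ω.1 ω.2 A.rounds) = G <;>
        simp [hg, estimateEvent, h]
    simp_rw [this]
    rw [integral_add ((integrable_const _).indicator (A.measurableSet_estimateEvent G))
      (integrable_const _), integral_indicator_const _ (A.measurableSet_estimateEvent G)]
    simp [mul_comm]
  have h3 : ∫ ω, (∑ j ∈ Finset.range A.rounds, ((A.select j ω.1 (A.history ω.1 ω.2 j)).card : ℝ))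
      ∂A.sampleLaw P ≤ n := by
    have := integral_mono_of_nonneg (μ := A.sampleLaw P)
      (f := fun ω => ∑ j ∈ Finset.range A.rounds, ((A.select j ω.1 (A.history ω.1 ω.2 j)).card : ℝ))
      (ae_of_all _ fun ω => Finset.sum_nonneg fun _ _ => Nat.cast_nonneg _)
      (integrable_const (n : ℝ)) (hn.mono fun ω h => by
        simp only [totalObservations] at h
        beta_reduce
        exact_mod_cast h)
    simpa using this
  rw [h1, h2] at key
  nlinarith [mul_le_mul_of_nonneg_left h3 hc]

/-- The estimate takes one value, so the events of distinct graphs have total probability 1, and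
each graph is counted at most `R` times. -/
lemma sum_estimateEvent_le {Q : Measure (EuclideanSpace ℝ (Fin p))} [IsProbabilityMeasure Q]
    {K : Type*} [Fintype K] (G : K → SimpleGraph (Fin p)) {R : ℝ}
    (hR : ∀ g, (Nat.card {k // G k = g} : ℝ) ≤ R) :
    ∑ k, (A.sampleLaw Q).real (A.estimateEvent (G k)) ≤ R := by
  classical
  have htot : ∑ g : SimpleGraph (Fin p), (A.sampleLaw Q).real (A.estimateEvent g) = 1 := by
    have := sum_measureReal_preimage_singleton (μ := A.sampleLaw Q)
      (f := fun ω => A.estimate ω.1 (A.history ω.1 ω.2 A.rounds)) Finset.univ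
      (fun g _ => A.measurableSet_estimateEvent g)
    rw [Finset.coe_univ, Set.preimage_univ, probReal_univ] at this
    exact this
  calc ∑ k, (A.sampleLaw Q).real (A.estimateEvent (G k))
      = ∑ g, ∑ k ∈ Finset.univ.filter fun k => G k = g,
          (A.sampleLaw Q).real (A.estimateEvent (G k)) := (Finset.sum_fiberwise _ _ _).symm
    _ = ∑ g, (Nat.card {k // G k = g} : ℝ) * (A.sampleLaw Q).real (A.estimateEvent g) := by
        refine Finset.sum_congr rfl fun g _ => ?_
        rw [Finset.sum_congr rfl (g := fun _ => (A.sampleLaw Q).real (A.estimateEvent g))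
          fun k hk => by rw [(Finset.mem_filter.1 hk).2], Finset.sum_const, nsmul_eq_mul,
          Nat.card_eq_fintype_card, Fintype.card_subtype]
    _ ≤ ∑ g, R * (A.sampleLaw Q).real (A.estimateEvent g) := by
        gcongr with g
        exact hR g
    _ = R := by rw [← Finset.mul_sum, htot, mul_one]

end ActiveLearner

/-! ### Counting relabellings and averaging over them -/

section Counting

/-- The values of `ρ` at one representative of each class of `e` are free, giving the power of
`Fintype.card X`. Every other point must then go into a known fibre of `f`, which leaves at most `M`
choices. -/
lemma card_perm_map_fibers_le {X Y : Type*} [Fintype X] [Fintype Y] {M : ℕ}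
    {f : X → Y} (hf : ∀ y, Nat.card {x // f x = y} ≤ M) {e : X → Y}
    (he : Function.Surjective e) :
    Nat.card {ρ : Equiv.Perm X // ∀ u w, e u = e w → f (ρ u) = f (ρ w)} ≤
      Fintype.card X ^ Fintype.card Y * M ^ (Fintype.card X - Fintype.card Y) := by
  classical
  have hemb : ∀ y, Nonempty ({x // f x = y} ↪ Fin M) := fun y =>
    Function.Embedding.nonempty_of_card_le (by
      simpa [Nat.card_eq_fintype_card] using hf y)
  obtain ⟨idx, hidx⟩ : ∃ idx : X → Fin M, ∀ x y, f x = f y → idx x = idx y → x = y := by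
    refine ⟨fun x => (hemb (f x)).some ⟨x, rfl⟩, fun x y hxy h => ?_⟩
    have : ∀ (y' : Y) (hy : f y = y'), (hemb (f y)).some ⟨y, rfl⟩ = (hemb y').some ⟨y, hy⟩ := by
      rintro _ rfl; rfl
    simp only at h
    rw [this (f x) hxy.symm] at h
    simpa using (hemb (f x)).some.injective h
  obtain ⟨r, hr⟩ := he.hasRightInverse
  have hcardN : Fintype.card {u // ¬ u ∈ Set.range r} = Fintype.card X - Fintype.card Y := by
    rw [Fintype.card_subtype_compl]
    congr 1
    exact (Fintype.card_congr (Equiv.ofInjective r hr.injective)).symm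
  have hcod : Nat.card ((Y → X) × ({u // ¬ u ∈ Set.range r} → Fin M)) =
      Fintype.card X ^ Fintype.card Y * M ^ (Fintype.card X - Fintype.card Y) := by
    rw [Nat.card_eq_fintype_card, Fintype.card_prod, Fintype.card_fun, Fintype.card_fun, hcardN,
      Fintype.card_fin]
  rw [← hcod]
  refine Nat.card_le_card_of_injective
    (fun ρ => (fun y => ρ.1 (r y), fun u => idx (ρ.1 u.1))) fun ρ ρ' h => ?_
  simp only [Prod.mk.injEq] at h
  obtain ⟨h1, h2⟩ := h
  refine Subtype.ext (Equiv.ext fun u => ?_)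
  by_cases hu : u ∈ Set.range r
  · obtain ⟨y, rfl⟩ := hu
    exact congrFun h1 y
  · refine hidx _ _ ?_ (congrFun h2 ⟨u, hu⟩)
    have hru : e u = e (r (e u)) := (hr (e u)).symm
    rw [ρ.2 _ _ hru, ρ'.2 _ _ hru, congrFun h1 (e u)]

end Counting

section Relabel

variable {p : ℕ} {J : Type*} [DecidableEq J]

lemma fiberCard_comp_equiv (c : Fin p → J) (e : Equiv.Perm (Fin p)) (j : J) :
    fiberCard (c ∘ e) j = fiberCard c j := by
  unfold fiberCard
  rw [← Fintype.card_subtype, ← Fintype.card_subtype]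
  exact Fintype.card_congr (e.subtypeEquiv fun u => Iff.rfl)

lemma cliqueGraph_eq_iff {V J : Type*} {c c' : V → J} :
    cliqueGraph c = cliqueGraph c' ↔ ∀ u w, c u = c w ↔ c' u = c' w := by
  constructor
  · intro h u w
    by_cases huw : u = w
    · subst huw; simp
    · have := congrArg (fun G => G.Adj u w) h
      simpa [cliqueGraph, huw] using this
  · intro h
    ext u w
    simp [cliqueGraph, h u w]

/-- The labels of `c` carried over by `σ`, after the permutation `π` of the nodes with label
in `B`. -/
def relabel (c : Fin p → J) (B : Finset J) (σ : Equiv.Perm (Fin p))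
    (π : Equiv.Perm {u // c u ∈ B}) : Fin p → J :=
  c ∘ (σ * Equiv.Perm.ofSubtype π).symm

lemma relabel_apply (c : Fin p → J) (B : Finset J) (σ : Equiv.Perm (Fin p))
    (π : Equiv.Perm {u // c u ∈ B}) (u : Fin p) :
    relabel c B σ π u = c (Equiv.Perm.ofSubtype π⁻¹ (σ.symm u)) := by
  rw [map_inv]; rfl

lemma referenceLaw_relabel (τ : ℝ) (c : Fin p → J) (B : Finset J) (σ : Equiv.Perm (Fin p))
    (π : Equiv.Perm {u // c u ∈ B}) :
    referenceLaw τ B (relabel c B σ π) = referenceLaw τ B (c ∘ σ.symm) := by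
  have hmem : ∀ x, c (Equiv.Perm.ofSubtype π⁻¹ x) ∈ B ↔ c x ∈ B := by
    intro x
    by_cases hx : c x ∈ B
    · rw [Equiv.Perm.ofSubtype_apply_of_mem (p := fun u => c u ∈ B) _ hx]
      exact iff_of_true (π⁻¹ ⟨x, hx⟩).2 hx
    · rw [Equiv.Perm.ofSubtype_apply_of_not_mem (p := fun u => c u ∈ B) _ hx]
  refine referenceLaw_congr (fun j => ?_) (fun u => ?_) fun u hu => ?_
  · rw [relabel, fiberCard_comp_equiv, fiberCard_comp_equiv]
  · rw [relabel_apply, hmem]; rfl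
  · rw [relabel_apply, hmem] at hu
    rw [relabel_apply, Equiv.Perm.ofSubtype_apply_of_not_mem (p := fun u => c u ∈ B) _ hu]
    rfl

lemma card_relabel_eq_le (c : Fin p → J) (B : Finset J) {M : ℕ}
    (hpos : ∀ j ∈ B, 0 < fiberCard c j) (hM : ∀ j ∈ B, fiberCard c j ≤ M)
    (σ : Equiv.Perm (Fin p)) (g : SimpleGraph (Fin p)) :
    Nat.card {π : Equiv.Perm {u // c u ∈ B} // cliqueGraph (relabel c B σ π) = g} ≤
      Fintype.card {u // c u ∈ B} ^ B.card *
        M ^ (Fintype.card {u // c u ∈ B} - B.card) := by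
  classical
  rcases isEmpty_or_nonempty
    {π : Equiv.Perm {u // c u ∈ B} // cliqueGraph (relabel c B σ π) = g} with hemp | ⟨⟨π₀, hπ₀⟩⟩
  · simp
  set f : {u // c u ∈ B} → B := fun u => ⟨c u, u.2⟩ with hf
  have hrel : ∀ π : Equiv.Perm {u // c u ∈ B}, ∀ x : {u // c u ∈ B},
      relabel c B σ π (σ x) = f (π⁻¹ x) := by
    intro π x
    rw [relabel_apply, Equiv.symm_apply_apply, Equiv.Perm.ofSubtype_apply_coe]
  have hfib : ∀ y : B, Nat.card {x // f x = y} ≤ M := by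
    intro y
    refine le_trans ?_ (hM y y.2)
    rw [fiberCard, ← Fintype.card_subtype, ← Nat.card_eq_fintype_card]
    refine Nat.card_le_card_of_injective (fun x => ⟨x.1.1, congrArg Subtype.val x.2⟩) ?_
    intro x y h
    exact Subtype.ext (Subtype.ext (by simpa using h))
  have hsurj : Function.Surjective f := by
    rintro ⟨j, hj⟩
    obtain ⟨u, hu⟩ := Finset.card_pos.1 (hpos j hj)
    have huj := (Finset.mem_filter.1 hu).2
    exact ⟨⟨u, huj ▸ hj⟩, Subtype.ext huj⟩
  have hcount := card_perm_map_fibers_le hfib (e := f ∘ ⇑(π₀⁻¹))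
    (hsurj.comp (π₀⁻¹).surjective)
  rw [Fintype.card_coe] at hcount
  have hinv : ∀ π : {π : Equiv.Perm {u // c u ∈ B} // cliqueGraph (relabel c B σ π) = g},
      ∀ u w, (f ∘ ⇑(π₀⁻¹)) u = (f ∘ ⇑(π₀⁻¹)) w → f (π.1⁻¹ u) = f (π.1⁻¹ w) := by
    intro π u w huw
    -- Two permutations producing the same graph have the same classes of labels, so the classes of
    -- `f ∘ π₀⁻¹` constrain every such `π⁻¹`.
    have hg := cliqueGraph_eq_iff.1 (π.2.trans hπ₀.symm) (σ u) (σ w)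
    rw [hrel, hrel, hrel, hrel] at hg
    exact Subtype.ext (hg.2 (congrArg Subtype.val huw))
  refine le_trans (Nat.card_le_card_of_injective (fun π => ⟨π.1⁻¹, hinv π⟩) ?_) hcount
  intro π π' h
  exact Subtype.ext (inv_injective (congrArg Subtype.val h))

end Relabel

section Ensemble

variable {p L : ℕ} {m : Fin L → ℕ}

lemma mem_cliqueEnsemble_iff (hsum : ∑ j, m j = p) {G : SimpleGraph (Fin p)} :
    G ∈ cliqueEnsemble p m ↔
      ∃ c : Fin p → Fin L, (∀ j, fiberCard c j = m j) ∧ cliqueGraph c = G := by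
  classical
  rw [cliqueEnsemble, Finset.mem_filter]
  simp only [Finset.mem_univ, true_and, IsDisjointCliques]
  constructor
  · rintro ⟨C, hcard, hdisj, hadj⟩
    -- The sizes add up to `p`, so the cliques cover all nodes and every node has exactly one label.
    have hcov : Finset.univ.biUnion C = Finset.univ := by
      apply Finset.eq_univ_of_card
      rw [Finset.card_biUnion fun i _ j _ h => hdisj i j h]
      simp [hcard, hsum]
    have hex : ∀ u, ∃ j, u ∈ C j := fun u => by
      have := Finset.mem_univ u
      rw [← hcov] at this
      simpa using this
    choose c hc using hex
    have huniq : ∀ u j, u ∈ C j ↔ c u = j := by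
      refine fun u j => ⟨fun h => ?_, fun h => h ▸ hc u⟩
      by_contra hne
      exact Finset.disjoint_left.1 (hdisj _ _ hne) (hc u) h
    refine ⟨c, fun j => ?_, ?_⟩
    · rw [← hcard j, fiberCard]
      congr 1
      ext u
      simp [huniq]
    · ext u v
      rw [hadj]
      simp only [cliqueGraph, huniq]
      exact and_congr_right fun _ => ⟨fun h => ⟨_, h, rfl⟩, fun ⟨j, h1, h2⟩ => h1.trans h2.symm⟩
  · rintro ⟨c, hc, rfl⟩
    refine ⟨fun j => Finset.univ.filter fun u => c u = j, hc, fun i j hij => ?_, fun u v => ?_⟩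
    · rw [Finset.disjoint_left]
      intro u hu hu'
      exact hij ((Finset.mem_filter.1 hu).2.symm.trans (Finset.mem_filter.1 hu').2)
    · simp only [cliqueGraph, Finset.mem_filter, Finset.mem_univ, true_and]
      exact and_congr_right fun _ => ⟨fun h => ⟨_, h, rfl⟩, fun ⟨j, h1, h2⟩ => h1.trans h2.symm⟩

lemma exists_perm_comp_eq {J : Type*} [DecidableEq J] {c c' : Fin p → J}
    (h : ∀ j, fiberCard c j = fiberCard c' j) : ∃ e : Equiv.Perm (Fin p), c ∘ e = c' := by
  have : ∀ j, Nonempty ({u // c' u = j} ≃ {u // c u = j}) := fun j => by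
    rw [← Fintype.card_eq, Fintype.card_subtype, Fintype.card_subtype]
    exact (h j).symm
  exact ⟨Equiv.ofFiberEquiv fun j => (this j).some, funext fun u => Equiv.ofFiberEquiv_map _ u⟩

lemma cliqueGraph_comp_mem_cliqueEnsemble (hsum : ∑ j, m j = p) {c : Fin p → Fin L}
    (hc : ∀ j, fiberCard c j = m j) (e : Equiv.Perm (Fin p)) :
    cliqueGraph (c ∘ e) ∈ cliqueEnsemble p m :=
  (mem_cliqueEnsemble_iff hsum).2 ⟨_, fun j => (fiberCard_comp_equiv c e j).trans (hc j), rfl⟩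

/-- A uniform relabelling of a graph of the ensemble is uniform on the ensemble. -/
lemma sum_perm_cliqueGraph (hsum : ∑ j, m j = p) {c : Fin p → Fin L}
    (hc : ∀ j, fiberCard c j = m j) (F : SimpleGraph (Fin p) → ℝ) :
    (∑ σ : Equiv.Perm (Fin p), F (cliqueGraph (c ∘ σ.symm))) * (cliqueEnsemble p m).card =
      Fintype.card (Equiv.Perm (Fin p)) * ∑ G ∈ cliqueEnsemble p m, F G := by
  classical
  set N : ℕ := (Finset.univ.filter fun σ : Equiv.Perm (Fin p) =>
    cliqueGraph (c ∘ σ.symm) = cliqueGraph c).card with hN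
  have hconst : ∀ G ∈ cliqueEnsemble p m, (Finset.univ.filter fun σ : Equiv.Perm (Fin p) =>
      cliqueGraph (c ∘ σ.symm) = G).card = N := by
    intro G hG
    obtain ⟨c', hc', rfl⟩ := (mem_cliqueEnsemble_iff hsum).1 hG
    obtain ⟨e, rfl⟩ := exists_perm_comp_eq (c := c) (c' := c') fun j => (hc j).trans (hc' j).symm
    rw [hN, ← Fintype.card_subtype, ← Fintype.card_subtype]
    -- Left multiplication by `e` matches the permutations producing `cliqueGraph (c ∘ e)` with
    -- those fixing `cliqueGraph c`.
    refine Fintype.card_congr ((Equiv.mulLeft e).subtypeEquiv fun σ => ?_)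
    rw [cliqueGraph_eq_iff, cliqueGraph_eq_iff]
    have hs : ∀ x, (Equiv.mulLeft e σ).symm x = σ.symm (e.symm x) := fun x => rfl
    simp only [Function.comp_apply, hs]
    constructor
    · intro h u w
      simpa using h (e.symm u) (e.symm w)
    · intro h u w
      simpa using h (e u) (e w)
  have hsumF : ∀ F : SimpleGraph (Fin p) → ℝ, ∑ σ : Equiv.Perm (Fin p),
      F (cliqueGraph (c ∘ σ.symm)) = N * ∑ G ∈ cliqueEnsemble p m, F G := by
    intro F
    rw [← Finset.sum_fiberwise_of_maps_to (s := Finset.univ) (t := cliqueEnsemble p m)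
      (g := fun σ : Equiv.Perm (Fin p) => cliqueGraph (c ∘ σ.symm))
      fun σ _ => cliqueGraph_comp_mem_cliqueEnsemble hsum hc _, Finset.mul_sum]
    refine Finset.sum_congr rfl fun G hG => ?_
    rw [Finset.sum_congr rfl (g := fun _ => F G)
      fun σ hσ => by rw [(Finset.mem_filter.1 hσ).2], Finset.sum_const, nsmul_eq_mul, hconst G hG]
  have hone := hsumF fun _ => 1
  simp only [Finset.sum_const, nsmul_eq_mul, mul_one, Finset.card_univ] at hone
  rw [hsumF F, hone]
  ring

end Ensemble

/-! ### Fano's inequality on the ensemble -/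

namespace ActiveLearner

variable {p L : ℕ} {m : Fin L → ℕ} (A : ActiveLearner p)

/-- Fano's inequality for the clique ensemble, with the cliques outside `B` revealed. -/
theorem one_sub_avgErrorProb_mul_log_le (hsum : ∑ j, m j = p) {c : Fin p → Fin L}
    (hc : ∀ j, fiberCard c j = m j) {B : Finset (Fin L)} {s M : ℕ} (hs : 0 < s)
    (hsB : ∀ j ∈ B, s ≤ m j) (hM : ∀ j ∈ B, m j ≤ M) {τ : ℝ} (h0 : 0 < τ) (h1 : τ < 1) {n : ℕ}
    (hA : A.WithinBudget τ (cliqueEnsemble p m) n) {κ : ℝ} (hκ : 1 ≤ κ)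
    (hκP : κ * (Fintype.card {u // c u ∈ B} ^ B.card *
        M ^ (Fintype.card {u // c u ∈ B} - B.card) : ℕ) ≤
      (Fintype.card {u // c u ∈ B}).factorial) :
    (1 - A.avgErrorProb τ (cliqueEnsemble p m)) * Real.log κ ≤
      Real.log (1 + (M * (τ / (1 - τ))) ^ 2) / (2 * s) * n + 1 := by
  classical
  set I := Real.log (1 + (M * (τ / (1 - τ))) ^ 2) / (2 * s) with hI
  have hI0 : 0 ≤ I := div_nonneg (Real.log_nonneg (by
    nlinarith [sq_nonneg ((M : ℝ) * (τ / (1 - τ)))])) (by positivity)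
  set T := cliqueEnsemble p m with hT
  set W := {u // c u ∈ B} with hW
  set succ : SimpleGraph (Fin p) → ℝ :=
    fun G => (A.sampleLaw (gaussianModel τ G)).real (A.estimateEvent G) with hsucc
  set R : ℝ := ((Fintype.card W ^ B.card * M ^ (Fintype.card W - B.card) : ℕ) : ℝ) with hR
  have hmem : ∀ σ (π : Equiv.Perm W), cliqueGraph (relabel c B σ π) ∈ T := fun σ π =>
    cliqueGraph_comp_mem_cliqueEnsemble hsum hc _
  have hfib : ∀ σ (π : Equiv.Perm W) j, fiberCard (relabel c B σ π) j = m j := fun σ π j =>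
    (fiberCard_comp_equiv c _ j).trans (hc j)
  have hcell : ∀ σ : Equiv.Perm (Fin p), (∑ π : Equiv.Perm W,
      succ (cliqueGraph (relabel c B σ π))) * Real.log κ ≤
      Fintype.card (Equiv.Perm W) * (I * n + 1) := by
    intro σ
    set Q := referenceLaw τ B (c ∘ σ.symm) with hQ
    have hone : ∀ π : Equiv.Perm W, succ (cliqueGraph (relabel c B σ π)) * Real.log κ ≤
        I * n + (κ - 1) * (A.sampleLaw Q).real (A.estimateEvent (cliqueGraph (relabel c B σ π))) := by
      intro π
      refine A.success_mul_log_le hI0 (fun z => ?_) (hA _ (hmem σ π)) hκ _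
      rw [hQ, ← referenceLaw_relabel τ c B σ π]
      exact gibbsBound_observe h0 h1 B _ hs (fun j hj => by rw [hfib]; exact hsB j hj)
        (fun j hj => by rw [hfib]; exact hM j hj) z
    have hev := A.sum_estimateEvent_le (Q := Q)
      (fun π : Equiv.Perm W => cliqueGraph (relabel c B σ π)) (R := R) fun g =>
        Nat.cast_le.2 (card_relabel_eq_le c B (fun j hj => by rw [hc]; exact hs.trans_le (hsB j hj))
          (fun j hj => by rw [hc]; exact hM j hj) σ g)
    have hsumle := Finset.sum_le_sum fun π (_ : π ∈ Finset.univ) => hone π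
    rw [← Finset.sum_mul, Finset.sum_add_distrib, Finset.sum_const, nsmul_eq_mul,
      Finset.card_univ, ← Finset.mul_sum] at hsumle
    have hcardW : ((Fintype.card W).factorial : ℝ) = Fintype.card (Equiv.Perm W) := by
      rw [Fintype.card_perm]
    have hR0 : 0 ≤ R := Nat.cast_nonneg _
    -- The hypothesis `κ * R ≤ P!` is used here: the reference term is at most 1 on average over
    -- `π`, which is the `+ 1` of the bound.
    have : (κ - 1) * ∑ π : Equiv.Perm W, (A.sampleLaw Q).real
        (A.estimateEvent (cliqueGraph (relabel c B σ π))) ≤ Fintype.card (Equiv.Perm W) := by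
      refine (mul_le_mul_of_nonneg_left hev (sub_nonneg.2 hκ)).trans ?_
      rw [← hcardW]
      linarith
    linarith
  -- For fixed `π`, the factor it adds is absorbed by translating `σ`.
  have hshift : ∀ π : Equiv.Perm W, ∑ σ : Equiv.Perm (Fin p),
      succ (cliqueGraph (relabel c B σ π)) = ∑ σ : Equiv.Perm (Fin p),
        succ (cliqueGraph (c ∘ σ.symm)) := fun π =>
    Equiv.sum_comp (Equiv.mulRight (Equiv.Perm.ofSubtype π))
      fun σ : Equiv.Perm (Fin p) => succ (cliqueGraph (c ∘ σ.symm))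
  have htotal : (Fintype.card (Equiv.Perm W) : ℝ) *
      (∑ σ : Equiv.Perm (Fin p), succ (cliqueGraph (c ∘ σ.symm))) * Real.log κ ≤
      Fintype.card (Equiv.Perm (Fin p)) * (Fintype.card (Equiv.Perm W) * (I * n + 1)) := by
    have h := Finset.sum_le_sum fun σ (_ : σ ∈ (Finset.univ : Finset (Equiv.Perm (Fin p)))) =>
      hcell σ
    rw [← Finset.sum_mul, Finset.sum_comm, Finset.sum_congr rfl fun π _ => hshift π,
      Finset.sum_const, Finset.sum_const, nsmul_eq_mul, nsmul_eq_mul, Finset.card_univ,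
      Finset.card_univ] at h
    exact h
  have hWpos : (0 : ℝ) < Fintype.card (Equiv.Perm W) := Nat.cast_pos.2 Fintype.card_pos
  have hppos : (0 : ℝ) < Fintype.card (Equiv.Perm (Fin p)) := Nat.cast_pos.2 Fintype.card_pos
  have hTpos : (0 : ℝ) < T.card :=
    Nat.cast_pos.2 (Finset.card_pos.2 ⟨_, hmem 1 1⟩)
  have hunif := sum_perm_cliqueGraph hsum hc succ
  rw [← hT] at hunif
  have havg : (1 - A.avgErrorProb τ T) * T.card = ∑ G ∈ T, succ G := by
    rw [avgErrorProb, sub_mul, div_mul_cancel₀ _ hTpos.ne']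
    simp only [errorProb_eq, Finset.sum_sub_distrib, Finset.sum_const, nsmul_eq_mul, mul_one,
      one_mul, sub_sub_cancel, hsucc]
  have hσ : ∑ σ : Equiv.Perm (Fin p), succ (cliqueGraph (c ∘ σ.symm)) =
      Fintype.card (Equiv.Perm (Fin p)) * (1 - A.avgErrorProb τ T) := by
    rw [← havg, ← mul_assoc] at hunif
    exact mul_right_cancel₀ hTpos.ne' hunif
  rw [hσ] at htotal
  have hpos := mul_pos hWpos hppos
  refine le_of_mul_le_mul_left ?_ hpos
  linarith

lemma avgErrorProb_nonneg (τ : ℝ) (T : Finset (SimpleGraph (Fin p))) :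
    0 ≤ A.avgErrorProb τ T :=
  div_nonneg (Finset.sum_nonneg fun _ _ => measureReal_nonneg) (Nat.cast_nonneg _)

end ActiveLearner

/-! ### Size of the cells and top degrees -/

lemma mul_log_sub_le_log_factorial (P : ℕ) :
    (P : ℝ) * Real.log P - P ≤ Real.log P.factorial := by
  rcases Nat.eq_zero_or_pos P with rfl | hP
  · simp
  have hP' : (0 : ℝ) < P := Nat.cast_pos.2 hP
  have hf : (0 : ℝ) < P.factorial := Nat.cast_pos.2 P.factorial_pos
  have h := Real.log_le_log (by positivity) (Real.pow_div_factorial_le_exp (P : ℝ) hP'.le P)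
  rw [Real.log_exp, Real.log_div (by positivity) hf.ne', Real.log_pow] at h
  linarith

/-- From `P! ≥ (P / e) ^ P` the logarithm is at least `(P - l) * log (P / M) - P`, and `l ≤ P / s`.
-/
lemma le_log_factorial_div {P l M s : ℕ} (hs : 0 < s) (hl : l * s ≤ P) (hM : 0 < M) (hMP : M ≤ P) :
    (P : ℝ) * ((1 - 1 / s) * Real.log (P / M) - 1) ≤
      Real.log (P.factorial / (P ^ l * M ^ (P - l) : ℕ)) := by
  have hP : (0 : ℝ) < P := Nat.cast_pos.2 (hM.trans_le hMP)
  have hM' : (0 : ℝ) < M := Nat.cast_pos.2 hM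
  have hs' : (0 : ℝ) < s := Nat.cast_pos.2 hs
  have hlP : l ≤ P := (Nat.le_mul_of_pos_right l hs).trans hl
  have hl' : (l : ℝ) ≤ P / s := by
    rw [le_div_iff₀ hs']; exact_mod_cast hl
  have hlog : 0 ≤ Real.log P - Real.log M := by
    rw [sub_nonneg]
    exact Real.log_le_log hM' (Nat.cast_le.2 hMP)
  have hfac := mul_log_sub_le_log_factorial P
  have hden : ((P ^ l * M ^ (P - l) : ℕ) : ℝ) ≠ 0 := by
    push_cast
    exact (mul_pos (pow_pos hP _) (pow_pos hM' _)).ne'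
  rw [Real.log_div (Nat.cast_pos.2 P.factorial_pos).ne' hden, Real.log_div hP.ne' hM'.ne']
  push_cast
  rw [Real.log_mul (pow_pos hP _).ne' (pow_pos hM' _).ne', Real.log_pow,
    Real.log_pow, Nat.cast_sub hlP]
  have hmul := mul_le_mul_of_nonneg_right hl' hlog
  have e : (P : ℝ) * ((1 - 1 / s) * (Real.log P - Real.log M) - 1) =
      P * (Real.log P - Real.log M) - P / s * (Real.log P - Real.log M) - P := by ring
  rw [e]
  linarith

section TopDegree

variable {p L : ℕ} {m : Fin L → ℕ}

lemma degree_cliqueGraph_add_one {c : Fin p → Fin L} (u : Fin p)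
    [Fintype ((cliqueGraph c).neighborSet u)] :
    (cliqueGraph c).degree u + 1 = fiberCard c (c u) := by
  classical
  rw [← SimpleGraph.card_neighborFinset_eq_degree, fiberCard]
  have : (Finset.univ.filter fun w => c w = c u) =
      insert u ((cliqueGraph c).neighborFinset u) := by
    ext w
    simp only [Finset.mem_filter, Finset.mem_univ, true_and, Finset.mem_insert,
      SimpleGraph.mem_neighborFinset]
    by_cases h : w = u
    · simp [h]
    · simp [cliqueGraph, h, Ne.symm h, eq_comm]
  rw [this, Finset.card_insert_of_notMem]
  simp

/-- What the top degree `d` among `k` nodes says on the sizes of the cliques. -/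
lemma IsMinTopDegree.card_le {c : Fin p → Fin L} (hc : ∀ j, fiberCard c j = m j) {k d : ℕ}
    (h : IsMinTopDegree (cliqueGraph c) k d) :
    k ≤ Fintype.card {u // c u ∈ Finset.univ.filter fun j => d + 1 ≤ m j} ∧
      ∃ j, m j = d + 1 := by
  classical
  obtain ⟨S, hS, -, ⟨u, huS, hu⟩, hleast⟩ := h
  constructor
  · rw [← hS, Fintype.card_subtype]
    refine Finset.card_le_card fun v hv => ?_
    have := hleast ⟨v, hv, rfl⟩
    have hd := degree_cliqueGraph_add_one (c := c) v
    rw [hc] at hd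
    simp only [Finset.mem_filter, Finset.mem_univ, true_and]
    rw [← hd]
    exact Nat.succ_le_succ (by convert this)
  · refine ⟨c u, ?_⟩
    rw [← hc, ← degree_cliqueGraph_add_one (c := c) u, ← hu]

lemma card_mul_le_card_subtype {c : Fin p → Fin L} (hc : ∀ j, fiberCard c j = m j)
    {B : Finset (Fin L)} {s : ℕ} (hs : ∀ j ∈ B, s ≤ m j) :
    B.card * s ≤ Fintype.card {u // c u ∈ B} := by
  rw [Fintype.card_subtype, Finset.card_eq_sum_card_fiberwise (f := c) (t := B)
    fun u hu => by simpa using hu, ← smul_eq_mul, ← Finset.sum_const]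
  refine Finset.sum_le_sum fun j hj => (hs j hj).trans (le_of_eq ?_)
  rw [← hc, fiberCard, Finset.filter_filter]
  congr 1
  ext u
  simp only [Finset.mem_filter, Finset.mem_univ, true_and]
  exact ⟨fun h => ⟨h ▸ hj, h⟩, fun h => h.2⟩

end TopDegree

/-! ### Explicit error term and the limit -/

/-- This moves all losses into a correction of `w`; `y ≥ 1 / 2` allows the additive 1 to be charged
to `2 * y`. -/
lemma mul_sub_error_le {x b c w y t : ℝ} (hx : 0 < x) (hb : 0 < b) (hc : 0 ≤ c) (hy : 1 / 2 ≤ y)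
    (hw1 : w ≤ 1) (h : w * (y * ((x - 1) * (b - c))) ≤ t + 1) (hw0 : 0 ≤ w) :
    y * (x * b) * (w - (2 / x + c / b + 2 / (x * b))) ≤ t := by
  have hxb : x * b * (2 / x + c / b + 2 / (x * b)) = 2 * b + c * x + 2 := by
    field_simp
  have h2 : x * b - b - c * x ≤ (x - 1) * (b - c) := by nlinarith
  have h3 : w * (y * (x * b - b - c * x)) ≤ w * (y * ((x - 1) * (b - c))) :=
    mul_le_mul_of_nonneg_left (mul_le_mul_of_nonneg_left h2 (by linarith)) hw0
  have h4 : w * (y * (b + c * x)) ≤ y * (b + c * x) :=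
    mul_le_of_le_one_left (mul_nonneg (by linarith) (by positivity)) hw1
  have h5 : y * (x * b) * (w - (2 / x + c / b + 2 / (x * b))) =
      w * (y * (x * b)) - y * (2 * b + c * x + 2) := by
    rw [← hxb]; ring
  have h6 : 0 ≤ y * b := mul_nonneg (by linarith) hb.le
  have h7 : w * (y * (x * b - b - c * x)) = w * (y * (x * b)) - w * (y * (b + c * x)) := by ring
  have h8 : y * (2 * b + c * x + 2) = y * (b + c * x) + y * b + 2 * y := by ring
  linarith

/-- The bound with an explicit error term. -/
theorem ActiveLearner.le_of_withinBudget {α : ℝ} (hα₀ : 0 < α) (hα₁ : α < 1) {p L : ℕ}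
    {m : Fin L → ℕ} (hm : ∀ j, 2 ≤ m j) (hsum : ∑ j, m j = p) {τ : ℝ} (h0 : 0 < τ) (h1 : τ < 1)
    {δ : ℝ} {n : ℕ} (A : ActiveLearner p) (hA : A.WithinBudget τ (cliqueEnsemble p m) n)
    (hδ : A.avgErrorProb τ (cliqueEnsemble p m) ≤ δ) {G : SimpleGraph (Fin p)}
    (hG : G ∈ cliqueEnsemble p m) {d : ℕ} (hd : IsMinTopDegree G ⌊α * (p : ℝ)⌋₊ d) :
    2 * α * (p : ℝ) * (d : ℝ) * Real.log ((p : ℝ) / (maxCliqueDegree m : ℝ)) /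
        Real.log (1 + (((maxCliqueDegree m : ℝ) + 1) * (τ / (1 - τ))) ^ 2) *
        (1 - δ - (2 / (α * p) +
          (Real.log (4 / α) + 2) / Real.log ((p : ℝ) / (maxCliqueDegree m : ℝ)) +
          2 / (α * p * Real.log ((p : ℝ) / (maxCliqueDegree m : ℝ))))) ≤ n := by
  classical
  obtain ⟨c, hc, rfl⟩ := (mem_cliqueEnsemble_iff hsum).1 hG
  obtain ⟨hcard, j₀, hj₀⟩ := hd.card_le hc
  set M := Finset.univ.sup m with hMdef
  have hmM : ∀ j, m j ≤ M := fun j => Finset.le_sup (Finset.mem_univ j)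
  obtain ⟨j₁, -, hj₁⟩ := Finset.exists_mem_eq_sup Finset.univ ⟨j₀, Finset.mem_univ _⟩ m
  have hM2 : 2 ≤ M := (hm j₀).trans (hmM j₀)
  set D := maxCliqueDegree m with hD
  have hDM : D + 1 = M := by
    rw [hD, maxCliqueDegree, ← hMdef]; omega
  have hMp : M ≤ p := by
    rw [← hsum, hMdef, hj₁]
    exact Finset.single_le_sum (f := m) (fun _ _ => Nat.zero_le _) (Finset.mem_univ j₁)
  have hd1 : 1 ≤ d := by have := hm j₀; omega
  have hDM' : (D : ℝ) + 1 = M := by exact_mod_cast hDM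
  have hD1 : (1 : ℝ) ≤ D := by
    have : 1 ≤ D := by omega
    exact_mod_cast this
  have hp0 : (0 : ℝ) < p := Nat.cast_pos.2 (by omega)
  have hDp : (D : ℝ) < p := by
    have : D < p := by omega
    exact_mod_cast this
  have hτ : 0 < 1 - τ := by linarith
  rw [hDM']
  set b := Real.log ((p : ℝ) / D) with hb
  have hb0 : 0 < b := Real.log_pos ((one_lt_div (by linarith)).2 hDp)
  set c₁ := Real.log (4 / α) + 2 with hc₁
  have hlog4 : 0 < Real.log (4 / α) := Real.log_pos ((one_lt_div hα₀).2 (by linarith))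
  have hc₁0 : 0 < c₁ := by linarith
  set Λ := Real.log (1 + ((M : ℝ) * (τ / (1 - τ))) ^ 2) with hΛ
  have hM0 : (0 : ℝ) < M := Nat.cast_pos.2 (by omega)
  have hΛ0 : 0 < Λ := by
    apply Real.log_pos
    have : 0 < ((M : ℝ) * (τ / (1 - τ))) ^ 2 := by positivity
    linarith
  have hd0 : (0 : ℝ) < d := Nat.cast_pos.2 (by omega)
  set x := α * (p : ℝ) with hx
  have hx0 : 0 < x := by positivity
  set ε := 2 / x + c₁ / b + 2 / (x * b) with hε
  have hcoef : 0 ≤ 2 * α * (p : ℝ) * d * b / Λ := by positivity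
  -- If `1 - δ ≤ ε` the claimed bound is not positive. Otherwise `ε < 1`, which forces `x > 2` and
  -- `b > c₁`.
  rcases le_or_gt (1 - δ) ε with hle | hlt
  · exact (mul_nonpos_of_nonneg_of_nonpos hcoef (by linarith)).trans (Nat.cast_nonneg _)
  have hδ0 : 0 ≤ δ := (A.avgErrorProb_nonneg _ _).trans hδ
  have hε1 : ε < 1 := by linarith
  have hδ1 : 0 ≤ 1 - δ := le_trans (by positivity) hlt.le
  have hx2 : 2 < x := by
    have : 2 / x < 1 := by
      have : 0 < c₁ / b + 2 / (x * b) := by positivity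
      linarith
    rwa [div_lt_one hx0] at this
  have hbc : c₁ < b := by
    have : c₁ / b < 1 := by
      have : 0 < 2 / x + 2 / (x * b) := by positivity
      linarith
    rwa [div_lt_one hb0] at this
  set B := Finset.univ.filter fun j => d + 1 ≤ m j with hB
  set P := Fintype.card {u // c u ∈ B} with hP
  have hPx : x - 1 ≤ P := by
    have h := Nat.lt_floor_add_one x
    have : ((⌊x⌋₊ : ℕ) : ℝ) ≤ P := by exact_mod_cast hcard
    linarith
  have hP0 : (0 : ℝ) < P := by linarith
  -- The 4 comes from two factors of 2: `M = D + 1 ≤ 2 * D`, and `P ≥ x - 1 ≥ x / 2`.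
  have hPM : b - Real.log (4 / α) ≤ Real.log (P / M) := by
    rw [hb, ← Real.log_div (by positivity) (by positivity)]
    refine Real.log_le_log (by positivity) ?_
    have h2 : (M : ℝ) ≤ 2 * D := by linarith
    have h3 : x / 2 ≤ P := by linarith
    calc (p : ℝ) / D / (4 / α) = x / 2 / (2 * D) := by
          rw [hx]; field_simp; norm_num
      _ ≤ P / M := by gcongr
  have hMP : M ≤ P := by
    have h : 0 < Real.log (P / M) := by linarith
    by_contra hlt'
    have : (P : ℝ) / M ≤ 1 := by
      rw [div_le_one hM0]; exact_mod_cast (not_le.1 hlt').le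
    exact absurd h (not_lt.2 (Real.log_nonpos (by positivity) this))
  have hsB : ∀ j ∈ B, d + 1 ≤ m j := fun j hj => (Finset.mem_filter.1 hj).2
  set κ : ℝ := P.factorial / (P ^ B.card * M ^ (P - B.card) : ℕ) with hκ
  have hlow := le_log_factorial_div (Nat.succ_pos d) (card_mul_le_card_subtype hc hsB)
    (by omega : 0 < M) hMP
  rw [← hP, ← hκ] at hlow
  set y : ℝ := 1 - 1 / ((d + 1 : ℕ) : ℝ) with hy
  have hyd : y = d / (d + 1) := by
    rw [hy]; push_cast; field_simp; ring
  have hy2 : 1 / 2 ≤ y := by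
    have : (1 : ℝ) ≤ d := by exact_mod_cast hd1
    rw [hyd, div_le_div_iff₀ (by norm_num) (by positivity)]; linarith
  have hlogκ : y * ((x - 1) * (b - c₁)) ≤ Real.log κ := by
    refine le_trans ?_ hlow
    -- The 2 in `c₁` pays for the `-1` of the factorial bound, because `y ≥ 1 / 2`.
    have h1 : y * (b - c₁) ≤ y * Real.log (P / M) - 1 := by
      have := mul_le_mul_of_nonneg_left hPM (by linarith : 0 ≤ y)
      rw [hc₁]; nlinarith
    calc y * ((x - 1) * (b - c₁)) = (x - 1) * (y * (b - c₁)) := by ring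
      _ ≤ P * (y * (b - c₁)) := by
          refine mul_le_mul_of_nonneg_right hPx (mul_nonneg (by linarith) (by linarith))
      _ ≤ _ := mul_le_mul_of_nonneg_left h1 hP0.le
  have hlogκ0 : 0 < Real.log κ :=
    lt_of_lt_of_le (mul_pos (by linarith) (mul_pos (by linarith) (by linarith))) hlogκ
  have hden : (0 : ℝ) < (P ^ B.card * M ^ (P - B.card) : ℕ) := by
    have : 0 < P := by exact_mod_cast hP0
    have : 0 < M := by omega
    exact Nat.cast_pos.2 (by positivity)
  have hκ0 : 0 < κ := div_pos (Nat.cast_pos.2 P.factorial_pos) hden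
  have hκ1 : 1 ≤ κ := ((Real.log_pos_iff hκ0.le).1 hlogκ0).le
  have hfano := A.one_sub_avgErrorProb_mul_log_le hsum hc (Nat.succ_pos d) hsB
    (fun j _ => hmM j) h0 h1 hA hκ1 (le_of_eq (div_mul_cancel₀ _ hden.ne'))
  rw [← hΛ] at hfano
  have hw : (1 - δ) * (y * ((x - 1) * (b - c₁))) ≤ Λ / (2 * ((d + 1 : ℕ) : ℝ)) * n + 1 := by
    refine le_trans ?_ hfano
    exact mul_le_mul (by linarith) hlogκ (mul_nonneg (by linarith)
      (mul_nonneg (by linarith) (by linarith))) (by linarith)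
  have hmain : y * (x * b) * (1 - δ - ε) ≤ Λ / (2 * ((d + 1 : ℕ) : ℝ)) * n :=
    mul_sub_error_le hx0 hb0 hc₁0.le hy2 (by linarith) hw hδ1
  have hfin : 2 * α * (p : ℝ) * d * b / Λ * (1 - δ - ε) =
      (2 * ((d + 1 : ℕ) : ℝ)) / Λ * (y * (x * b) * (1 - δ - ε)) := by
    rw [hyd, hx]; push_cast; field_simp
  rw [hfin]
  calc _ ≤ (2 * ((d + 1 : ℕ) : ℝ)) / Λ * (Λ / (2 * ((d + 1 : ℕ) : ℝ)) * n) :=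
        mul_le_mul_of_nonneg_left hmain (by positivity)
    _ = n := by field_simp

theorem mainTheorem5
    (α : ℝ) (hα₀ : 0 < α) (hα₁ : α < 1)
    (p L : ℕ → ℕ) (m : (k : ℕ) → Fin (L k) → ℕ)
    (hp : Tendsto p atTop atTop)
    (hm : ∀ k j, 2 ≤ m k j)
    (hsum : ∀ k, ∑ j, m k j = p k)
    (hmax : Tendsto (fun k => ((Finset.univ.sup (m k) : ℕ) : ℝ) / (p k : ℝ)) atTop (𝓝 0)) :
    ∃ ε : ℕ → ℝ, Tendsto ε atTop (𝓝 0) ∧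
      ∀ (k : ℕ) (τ : ℝ), 0 < τ → τ < 1 →
      ∀ (δ : ℝ) (n : ℕ) (A : ActiveLearner (p k)),
        A.WithinBudget τ (cliqueEnsemble (p k) (m k)) n →
        A.avgErrorProb τ (cliqueEnsemble (p k) (m k)) ≤ δ →
        ∀ G ∈ cliqueEnsemble (p k) (m k), ∀ dmin : ℕ,
          IsMinTopDegree G ⌊α * (p k : ℝ)⌋₊ dmin →
          (n : ℝ) ≥
            2 * α * (p k : ℝ) * (dmin : ℝ) *
                Real.log ((p k : ℝ) / (maxCliqueDegree (m k) : ℝ)) /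
              Real.log (1 + (((maxCliqueDegree (m k) : ℝ) + 1) * (τ / (1 - τ))) ^ 2) *
              (1 - δ - ε k) := by
  refine ⟨fun k => 2 / (α * p k) +
    (Real.log (4 / α) + 2) / Real.log ((p k : ℝ) / (maxCliqueDegree (m k) : ℝ)) +
    2 / (α * p k * Real.log ((p k : ℝ) / (maxCliqueDegree (m k) : ℝ))), ?_,
    fun k τ h0 h1 δ n A hA hδ G hG d hd =>
      A.le_of_withinBudget hα₀ hα₁ (hm k) (hsum k) h0 h1 hA hδ hG hd⟩
  have hp' : Tendsto (fun k => (p k : ℝ)) atTop atTop := tendsto_natCast_atTop_atTop.comp hp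
  have hx : Tendsto (fun k => α * (p k : ℝ)) atTop atTop := hp'.const_mul_atTop hα₀
  have hratio : Tendsto (fun k => (maxCliqueDegree (m k) : ℝ) / p k) atTop (𝓝 0) := by
    refine squeeze_zero (fun k => by positivity) (fun k => ?_) hmax
    gcongr
    exact Nat.sub_le _ _
  -- Positivity is needed to invert the limit: with largest degree 0 the quotient `p / 0` would be 0
  -- and not large.
  have hpos : ∀ᶠ k in atTop, (0 : ℝ) < (maxCliqueDegree (m k) : ℝ) / p k := by
    filter_upwards [hp.eventually_gt_atTop 0] with k hk
    have hL : Nonempty (Fin (L k)) := by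
      by_contra h
      rw [not_nonempty_iff] at h
      have := hsum k
      simp at this
      omega
    obtain ⟨j⟩ := hL
    have h2 : 2 ≤ Finset.univ.sup (m k) := (hm k j).trans (Finset.le_sup (Finset.mem_univ j))
    have : 0 < maxCliqueDegree (m k) := by unfold maxCliqueDegree; omega
    positivity
  have hinv : Tendsto (fun k => (p k : ℝ) / (maxCliqueDegree (m k) : ℝ)) atTop atTop := by
    have := (tendsto_inv_nhdsGT_zero (𝕜 := ℝ)).comp
      (tendsto_nhdsWithin_iff.2 ⟨hratio, hpos⟩)
    refine this.congr fun k => ?_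
    simp [inv_div]
  have hb := Real.tendsto_log_atTop.comp hinv
  have t1 := hx.const_div_atTop 2
  have t2 := hb.const_div_atTop (Real.log (4 / α) + 2)
  have t3 := (hx.atTop_mul_atTop₀ hb).const_div_atTop 2
  simpa using (t1.add t2).add t3
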